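/- All graphs are finite and simple, and nonempty means having at least one vertex; $v(G)=v_G$ and $e(G)=e_G$ are the numbers of vertices and edges of $G$; $J\subseteq H$ means that $J$ is a (not necessarily induced) subgraph of $H$. For a nonempty graph $H$ put \[ m(H)=\max\Big\{\tfrac{e_J}{v_J}: J\subseteq H,\ v_J>0\Big\},\qquad m_1(H)=\max\Big\{\tfrac{e_J}{v_J-1}: J\subseteq H,\ v_J\ge 2\Big\} \] (with $m_1(H)=0$ if $H$ has only one vertex), and for graphs $F,H$ with at least one edge and $m_1(F)\le m_1(H)$ put \[ m_K(F,H)=\max\Big\{\tfrac{m_1(F)+e_J}{v_J}: J\subseteq H,\ v_J\ge 2\Big\}. \] For nonempty graphs $F,H$ define \[ \beta(F,H)=\begin{cases} m_K(F,H) & \text{if } m_1(F)\le m_1(H),\ e(F)\ge 1,\\ m_K(H,F) & \text{if } m_1(H)<m_1(F),\ e(H)\ge 1,\\ m(H) & \text{if } e(F)=0,\ e(H)\ge 1,\\ m(F) & \text{if } e(H)=0,\ e(F)\ge 1,\\ 0 & \text{if } e(F)=e(H)=0. \end{cases} \] **Proposition 2.1.** Let $\mathcal F$ and $\mathcal H$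 be two finite families, each with at least one member, of nonempty graphs, let \[ m=\min_{F\in\mathcal F,\ H\in\mathcal H}\beta(F,H), \] and assume that $m>0$ (equivalently, it is not the case that both families contain a graph without edges). If $p=p(n)\in[0,1]$ satisfies $p=o\big(n^{-1/m}\big)$ as $n\to\infty$, then with probability tending to $1$ as $n\to\infty$ the vertices of the binomial random graph $G(n,p)$ can be coloured red and blue so that there is no copy (as a not necessarily induced subgraph) of any $F\in\mathcal F$ with all vertices red and no copy of any $H\in\mathcal H$ with all vertices blue. -/

import Mathlib

open Filter Topology Asymptotics

noncomputable section

namespace VertexRamsey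

/-- The number of edges `e(G)` of a (finite) graph. -/
def numEdges {V : Type*} (G : SimpleGraph V) : ℕ := G.edgeSet.ncard

/-- The density `m(H) = max { e_J / v_J : J ⊆ H, v_J > 0 }`, over all (not necessarily induced)
subgraphs `J` of `H`. For finite `H` the set is finite, so the supremum is a maximum. -/
def maxDensity {V : Type*} (H : SimpleGraph V) : ℝ :=
  sSup {x : ℝ | ∃ J : H.Subgraph, 0 < J.verts.ncard ∧
    x = (J.edgeSet.ncard : ℝ) / (J.verts.ncard : ℝ)}

/-- The `1`-density `m₁(H) = max { e_J / (v_J - 1) : J ⊆ H, v_J ≥ 2 }`. For finite `H` the set is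
finite, so the supremum is a maximum; it is `0` if `H` has fewer than two vertices. -/
def oneDensity {V : Type*} (H : SimpleGraph V) : ℝ :=
  sSup {x : ℝ | ∃ J : H.Subgraph, 2 ≤ J.verts.ncard ∧
    x = (J.edgeSet.ncard : ℝ) / ((J.verts.ncard : ℝ) - 1)}

/-- The Kreuter density `m_K(F, H) = max { (m₁(F) + e_J) / v_J : J ⊆ H, v_J ≥ 2 }` (meaningful
when `F` and `H` have at least one edge and `m₁(F) ≤ m₁(H)`). -/
def kreuterDensity {V W : Type*} (F : SimpleGraph V) (H : SimpleGraph W) : ℝ :=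
  sSup {x : ℝ | ∃ J : H.Subgraph, 2 ≤ J.verts.ncard ∧
    x = (oneDensity F + (J.edgeSet.ncard : ℝ)) / (J.verts.ncard : ℝ)}

open Classical in
/-- The exponent `β(F, H)` for the pair of graphs `(F, H)`. -/
def beta {V W : Type*} (F : SimpleGraph V) (H : SimpleGraph W) : ℝ :=
  if oneDensity F ≤ oneDensity H ∧ 1 ≤ numEdges F then kreuterDensity F H
  else if oneDensity H < oneDensity F ∧ 1 ≤ numEdges H then kreuterDensity H F
  else if numEdges F = 0 ∧ 1 ≤ numEdges H then maxDensity H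
  else if numEdges H = 0 ∧ 1 ≤ numEdges F then maxDensity F
  else 0

/-- The two colours. -/
inductive Colour where
  | red
  | blue

/-- Under the vertex colouring `c`, the graph `G` contains a (not necessarily induced) copy of `F`
all of whose vertices have colour `k`. -/
def HasCopyOfColour {V W : Type*} (G : SimpleGraph W) (c : W → Colour) (k : Colour)
    (F : SimpleGraph V) : Prop :=
  ∃ f : SimpleGraph.Copy F G, ∀ v : V, c (f v) = k

end VertexRamsey

end

namespace VertexRamsey
-- Deterministic part. Let `μ` be the least 1-density in the two families, attained, say, on the red
-- side. Every red copy contains a vertex set with e ≥ μ(v - 1) and, by the choice of `m`, every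
-- blue copy contains one with e ≥ m v - μ; it is enough to look at inclusion-minimal such sets
-- (`IsCritical`). If no colouring works, every vertex set meeting all blue critical sets contains a
-- red one. In a minimal family of blue critical sets with this property (`IsObstruction`) the
-- pieces interlock: each vertex of a blue set is its only common vertex with some red set, and red
-- or blue sets cross the boundary of every proper part of the union `V`. Hence `V` has at least
-- m|V| edges and can be built up by bounded steps, each gaining at least `m` edges per new vertex
-- (`exists_explorable`). If a family contains an edgeless graph, a single colour is used, and a
-- copy of a graph of the other family contains such a `V`.
--
-- Probabilistic part. `V` may be arbitrarily large, so its exploration is cut off once m v edges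
-- are seen on v vertices. Starting from one vertex leaves a deficit `m`; tree steps (gluing at one
-- vertex) do not increase it and every dense step lowers it by at least a fixed `δ`, so boundedly
-- many steps are dense. With tree steps performed in the order of a monotone pointer, the number of
-- encodings with `L` steps is at most exponential in `L` (`exists_card_sketches_le`). An encoding
-- with v vertices and e ≥ max(m v, L) edges occurs with probability at most n^v p^e ≤ c^e when p ≤
-- c n^(-1/m). As c may be taken arbitrarily small, summing over `L` gives a small geometric series
-- (`tendsto_explorable`).
open scoped Classical in
/-- The edges of `G` with both ends in `S`. -/
noncomputable def edgesIn {A : Type*} [Finite A] (G : SimpleGraph A) (S : Finset A) :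
    Finset (Sym2 A) :=
  S.sym2.filter (· ∈ G.edgeSet)

/-- A vertex set `V` of edge density at least `m` that can be explored from any nonempty part of
it by adding sets `B` of at most `K` vertices: either glued on at a single vertex, with at least
`m` edges per new vertex, or with more than `m` new edges per new vertex. -/
def Explorable {A : Type*} [Finite A] [DecidableEq A] (G : SimpleGraph A) (m : ℝ) (K : ℕ) (V : Finset A) : Prop :=
  V.Nonempty ∧ m * V.card ≤ (edgesIn G V).card ∧
  ∀ S : Finset A, S.Nonempty → S ⊂ V → ∃ B : Finset A, B ⊆ V ∧ B.card ≤ K ∧ ¬ B ⊆ S ∧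
    (((B ∩ S).card = 1 ∧ m * (B \ S).card ≤ (edgesIn G B).card) ∨
      m * (B \ S).card + (edgesIn G (B ∩ S)).card < (edgesIn G B).card)

/-! ### Edges inside vertex sets and critical sets -/

section
variable {A : Type*} [Finite A] {G : SimpleGraph A}

theorem mem_edgesIn {S : Finset A} {e : Sym2 A} :
    e ∈ edgesIn G S ↔ (∀ a ∈ e, a ∈ S) ∧ e ∈ G.edgeSet := by
  simp [edgesIn, Finset.mem_sym2_iff]

theorem edgesIn_mono {S T : Finset A} (h : S ⊆ T) : edgesIn G S ⊆ edgesIn G T := by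
  intro e he
  rw [mem_edgesIn] at *
  exact ⟨fun a ha => h (he.1 a ha), he.2⟩

theorem edgesIn_eq_empty_of_card_le_one {S : Finset A} (h : S.card ≤ 1) : edgesIn G S = ∅ := by
  ext e
  induction e using Sym2.ind with
  | _ x y =>
    simp only [mem_edgesIn, Finset.notMem_empty, iff_false, not_and, SimpleGraph.mem_edgeSet]
    intro hS hxy
    exact hxy.ne (Finset.card_le_one.1 h x (hS x (by simp)) y (hS y (by simp)))

theorem edgesIn_inter [DecidableEq A] (S T : Finset A) :
    edgesIn G (S ∩ T) = edgesIn G S ∩ edgesIn G T := by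
  ext e
  simp only [mem_edgesIn, Finset.mem_inter]
  grind

theorem card_edgesIn_sdiff [DecidableEq A] (S T : Finset A) :
    ((edgesIn G S \ edgesIn G T).card : ℝ) + (edgesIn G (S ∩ T)).card = (edgesIn G S).card := by
  rw [edgesIn_inter]
  exact_mod_cast Finset.card_sdiff_add_card_inter _ _

/-- `R` is minimal among the sets with `e(R) ≥ a * |R| - b` and at least two vertices. -/
def IsCritical (G : SimpleGraph A) (a b : ℝ) (R : Finset A) : Prop :=
  2 ≤ R.card ∧ a * R.card - b ≤ (edgesIn G R).card ∧
    ∀ J ⊂ R, 2 ≤ J.card → ((edgesIn G J).card : ℝ) < a * J.card - b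

theorem exists_isCritical_subset {a b : ℝ} {R : Finset A} (h2 : 2 ≤ R.card)
    (h : a * R.card - b ≤ (edgesIn G R).card) : ∃ T ⊆ R, IsCritical G a b T := by
  obtain ⟨T, hTR, hT⟩ := exists_minimal_le_of_wellFoundedLT
    (fun T : Finset A => 2 ≤ T.card ∧ a * T.card - b ≤ (edgesIn G T).card) R ⟨h2, h⟩
  refine ⟨T, hTR, hT.1.1, hT.1.2, fun J hJ hJ2 => ?_⟩
  by_contra! hlt
  exact hJ.2 (hT.2 ⟨hJ2, hlt⟩ hJ.1)

variable [DecidableEq A]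

/-- The edges of a critical set outside a nonempty part. -/
theorem IsCritical.le_card_sdiff {a b : ℝ} (hab : b ≤ a) {R : Finset A} (h : IsCritical G a b R)
    {S : Finset A} (hS : (R ∩ S).Nonempty) :
    a * (R \ S).card ≤ (edgesIn G R \ edgesIn G S).card := by
  have h1 := card_edgesIn_sdiff (G := G) R S
  have h2 : ((R \ S).card : ℝ) + (R ∩ S).card = R.card := by
    exact_mod_cast Finset.card_sdiff_add_card_inter R S
  have h3 := h.2.1
  -- A single common vertex spans no edge, and there `b ≤ a` pays for it; a larger proper
  -- intersection is sparse by minimality of `R`.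
  rcases Nat.lt_or_ge (R ∩ S).card 2 with h4 | h4
  · have h5 : (R ∩ S).card = 1 := by have := hS.card_pos; omega
    rw [edgesIn_eq_empty_of_card_le_one h5.le, Finset.card_empty, Nat.cast_zero, add_zero] at h1
    rw [← h2, h5, mul_add] at h3
    push_cast at h3
    linarith
  · rcases (Finset.inter_subset_left : R ∩ S ⊆ R).eq_or_ssubset with h5 | h5
    · have : R \ S = ∅ := by rw [Finset.sdiff_eq_empty_iff_subset]; exact Finset.inter_eq_left.1 h5
      simp [this]
    · have := h.2.2 _ h5 h4
      rw [← h2, mul_add] at h3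
      linarith

/-- The intersection is now a proper subset with at least two vertices, so minimality bounds its
edges strictly; this strictness is what makes dense steps dense. -/
theorem IsCritical.lt_card_sdiff {a b : ℝ} {R : Finset A} (h : IsCritical G a b R)
    {S : Finset A} (hS : 2 ≤ (R ∩ S).card) (hRS : ¬ R ⊆ S) :
    a * (R \ S).card < (edgesIn G R \ edgesIn G S).card := by
  have h1 := card_edgesIn_sdiff (G := G) R S
  have h2 : ((R \ S).card : ℝ) + (R ∩ S).card = R.card := by
    exact_mod_cast Finset.card_sdiff_add_card_inter R S
  have h3 := h.2.1
  have h5 : R ∩ S ⊂ R := Finset.inter_subset_left.ssubset_of_ne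
    fun h => hRS (Finset.inter_eq_left.1 h)
  have := h.2.2 _ h5 hS
  rw [← h2, mul_add] at h3
  linarith
end
-- Gluing blue sets onto a red set; minimal obstructions
section
variable {A : Type*} [Finite A] [DecidableEq A] {G : SimpleGraph A} {μ m : ℝ} {K : ℕ}

/-- The number of edges gained when a critical set is glued on along `u`, no edge at `u` being
present before. -/
theorem IsCritical.le_card_sdiff_erase {B W : Finset A} (h : IsCritical G m μ B) {u : A}
    (huB : u ∈ B) (huW : u ∈ W) :
    m * ((B \ W).card + 1) - μ ≤ (edgesIn G B \ edgesIn G (W.erase u)).card ∨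
      (B ∩ W.erase u).Nonempty := by
  rw [or_iff_not_imp_right, Finset.not_nonempty_iff_eq_empty]
  intro h0
  have h1 := card_edgesIn_sdiff (G := G) B (W.erase u)
  have h4 : edgesIn G (∅ : Finset A) = ∅ := edgesIn_eq_empty_of_card_le_one (by simp)
  rw [h0, h4, Finset.card_empty, Nat.cast_zero, add_zero] at h1
  have h2 : (B \ W).card + 1 = B.card := by
    have : B ∩ W = {u} := by
      ext x
      have := Finset.ext_iff.1 h0 x
      simp only [Finset.mem_inter, Finset.mem_erase, Finset.notMem_empty, iff_false,
        Finset.mem_singleton] at *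
      grind
    rw [← Finset.card_sdiff_add_card_inter B W, this, Finset.card_singleton]
  have h3 := h.2.1
  rw [h1]
  rw [← h2] at h3
  exact_mod_cast h3

/-- Since `B` meets `W` also off `u`, it can be regarded as glued to `W.erase u`, with `u` counted
among the new vertices. The loss of `μ` disappears. -/
theorem IsCritical.le_card_sdiff_erase_of_nonempty (hμm : μ ≤ m) {B W : Finset A}
    (h : IsCritical G m μ B) {u : A}
    (huB : u ∈ B) (huW : u ∈ W) (hne : (B ∩ W.erase u).Nonempty) :
    m * ((B \ W).card + 1) ≤ (edgesIn G B \ edgesIn G (W.erase u)).card := by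
  have h1 := h.le_card_sdiff hμm hne
  have h2 : B \ W.erase u = insert u (B \ W) := by
    ext x
    simp only [Finset.mem_sdiff, Finset.mem_erase, Finset.mem_insert]
    grind
  rw [h2, Finset.card_insert_of_notMem (by simp [huW])] at h1
  exact_mod_cast h1

/-- Edges of `B` that were counted before avoid `u`: `B` shares only `u` with `R`, hence no edge,
and an earlier `f t` meets `R` only in `t ≠ u`. -/
theorem edgesIn_inter_subset_erase {R S B W : Finset A} {f : A → Finset A} {T : Finset A} {u : A}
    (hW : T.biUnion f ⊆ W) (hu : u ∉ T) (hf : ∀ t ∈ T, f t ∩ R = {t}) (hB : B ∩ R = {u}) :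
    edgesIn G B ∩ ((edgesIn G R \ edgesIn G S) ∪ T.biUnion fun t => edgesIn G (f t)) ⊆
      edgesIn G (W.erase u) := by
  intro e he
  simp only [Finset.mem_inter, Finset.mem_union, Finset.mem_sdiff, Finset.mem_biUnion] at he
  obtain ⟨heB, ⟨heR, -⟩ | ⟨t, ht, het⟩⟩ := he
  · have : e ∈ edgesIn G (B ∩ R) := by rw [edgesIn_inter]; exact Finset.mem_inter.2 ⟨heB, heR⟩
    rw [hB, edgesIn_eq_empty_of_card_le_one (by simp)] at this
    simp at this
  · rw [mem_edgesIn] at het ⊢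
    refine ⟨fun a ha => Finset.mem_erase.2 ⟨?_, hW (Finset.mem_biUnion.2 ⟨t, ht, het.1 a ha⟩)⟩,
      het.2⟩
    rintro rfl
    have h1 : a ∈ f t ∩ R := by
      refine Finset.mem_inter.2 ⟨het.1 a ha, ?_⟩
      have : a ∈ B ∩ R := by rw [hB]; simp
      exact (Finset.mem_inter.1 this).2
    rw [hf t ht, Finset.mem_singleton] at h1
    exact hu (h1 ▸ ht)

/-- Edges of a red set with blue sets glued on at some of its vertices. -/
theorem le_card_edges_glued (hμ : 0 ≤ μ) (hμm : μ ≤ m) {R S : Finset A} {f : A → Finset A}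
    {T : Finset A} (hT : T ⊆ R) (hf : ∀ u ∈ T, IsCritical G m μ (f u) ∧ f u ∩ R = {u}) :
    (edgesIn G R \ edgesIn G S).card + T.card * (m - μ) + m * ((R ∪ T.biUnion f) \ R).card ≤
      (((edgesIn G R \ edgesIn G S) ∪ T.biUnion fun u => edgesIn G (f u)).card : ℝ) := by
  induction T using Finset.induction_on with
  | empty => simp
  | insert u T hu ih =>
    have ih := ih (fun x hx => hT (Finset.mem_insert_of_mem hx))
      (fun x hx => hf x (Finset.mem_insert_of_mem hx))
    obtain ⟨hfu, hfuR⟩ := hf u (Finset.mem_insert_self _ _)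
    set W := R ∪ T.biUnion f with hW
    set Y := (edgesIn G R \ edgesIn G S) ∪ T.biUnion fun u => edgesIn G (f u) with hY
    have huR : u ∈ R := hT (Finset.mem_insert_self _ _)
    have huf : u ∈ f u := by
      have : u ∈ f u ∩ R := by rw [hfuR]; simp
      exact (Finset.mem_inter.1 this).1
    have huW : u ∈ W := Finset.mem_union_left _ huR
    have h1 : (R ∪ (insert u T).biUnion f) \ R = (W \ R) ∪ (f u \ W) := by
      ext x
      simp only [hW, Finset.mem_sdiff, Finset.mem_union, Finset.biUnion_insert]
      grind
    have h2 : ((R ∪ (insert u T).biUnion f) \ R).card = (W \ R).card + (f u \ W).card := by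
      rw [h1, Finset.card_union_of_disjoint]
      rw [Finset.disjoint_left]
      simp only [Finset.mem_sdiff]
      grind
    have h3 : (edgesIn G R \ edgesIn G S) ∪ (insert u T).biUnion (fun u => edgesIn G (f u)) =
        Y ∪ (edgesIn G (f u) \ Y) := by
      rw [Finset.biUnion_insert, Finset.union_sdiff_self_eq_union, hY]
      ext x
      simp only [Finset.mem_union]
      tauto
    have h4 : ((edgesIn G R \ edgesIn G S) ∪
        (insert u T).biUnion (fun u => edgesIn G (f u))).card =
        Y.card + (edgesIn G (f u) \ Y).card := by
      rw [h3, Finset.card_union_of_disjoint Finset.disjoint_sdiff]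
    have h5 : (edgesIn G (f u) \ edgesIn G (W.erase u)).card ≤ (edgesIn G (f u) \ Y).card := by
      apply Finset.card_le_card
      have := edgesIn_inter_subset_erase (G := G) (S := S) (W := W) Finset.subset_union_right hu
        (fun t ht => (hf t (Finset.mem_insert_of_mem ht)).2) hfuR
      intro e he
      rw [Finset.mem_sdiff] at he ⊢
      exact ⟨he.1, fun h => he.2 (this (Finset.mem_inter.2 ⟨he.1, h⟩))⟩
    -- The worst case is that `f u` meets `W` in `u` alone; any further overlap saves `μ`.
    have h6 : m * ((f u \ W).card + 1) - μ ≤ (edgesIn G (f u) \ edgesIn G (W.erase u)).card := by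
      rcases hfu.le_card_sdiff_erase huf huW with h | h
      · exact h
      · linarith [hfu.le_card_sdiff_erase_of_nonempty hμm huf huW h]
    rw [h2, h4, Finset.card_insert_of_notMem hu]
    push_cast
    have h5' : ((edgesIn G (f u) \ edgesIn G (W.erase u)).card : ℝ) ≤
      (edgesIn G (f u) \ Y).card := by exact_mod_cast h5
    linarith

variable (G μ K) in
/-- `U` meets all members of `𝓑` and contains no red critical set. -/
def IsGood (𝓑 : Finset (Finset A)) (U : Finset A) : Prop :=
  (∀ B ∈ 𝓑, (B ∩ U).Nonempty) ∧ ∀ R, IsCritical G μ μ R → R.card ≤ K → ¬ R ⊆ U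

variable (G μ m K) in
/-- A minimal family of blue critical sets without a good set. -/
structure IsObstruction (𝓑 : Finset (Finset A)) : Prop where
  blue : ∀ B ∈ 𝓑, IsCritical G m μ B
  card_le : ∀ B ∈ 𝓑, B.card ≤ K
  not_good : ∀ U, ¬ IsGood G μ K 𝓑 U
  exists_good : ∀ 𝓑' ⊂ 𝓑, ∃ U, IsGood G μ K 𝓑' U

theorem IsGood.mono {𝓑 : Finset (Finset A)} {U U' : Finset A} (h : IsGood G μ K 𝓑 U)
    (hU : U' ⊆ U) (hB : ∀ B ∈ 𝓑, (B ∩ U').Nonempty) : IsGood G μ K 𝓑 U' :=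
  ⟨hB, fun R h1 h2 h3 => h.2 R h1 h2 (h3.trans hU)⟩

theorem IsGood.inter {𝓑 : Finset (Finset A)} {U V : Finset A} (h : IsGood G μ K 𝓑 U)
    (hV : ∀ B ∈ 𝓑, B ⊆ V) : IsGood G μ K 𝓑 (U ∩ V) := by
  refine h.mono Finset.inter_subset_left fun B hB => ?_
  obtain ⟨x, hx⟩ := h.1 B hB
  rw [Finset.mem_inter] at hx
  exact ⟨x, by simp [hx.1, hx.2, hV B hB hx.1]⟩

theorem exists_isObstruction
    (h : ∀ U : Finset A, (∀ B, IsCritical G m μ B → B.card ≤ K → (B ∩ U).Nonempty) →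
      ∃ R, IsCritical G μ μ R ∧ R.card ≤ K ∧ R ⊆ U) :
    ∃ 𝓑, IsObstruction G μ m K 𝓑 := by
  classical
  cases nonempty_fintype A
  obtain ⟨𝓑, h𝓑, hmin⟩ := exists_minimal_le_of_wellFoundedLT
    (fun 𝓑 : Finset (Finset A) => ∀ U, ¬ IsGood G μ K 𝓑 U)
    (Finset.univ.filter fun B => IsCritical G m μ B ∧ B.card ≤ K) (by
      intro U hU
      obtain ⟨R, h1, h2, h3⟩ := h U fun B h1 h2 => hU.1 B (by simp [h1, h2])
      exact hU.2 R h1 h2 h3)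
  refine ⟨𝓑, fun B hB => ?_, fun B hB => ?_, hmin.1, fun 𝓑' h' => ?_⟩
  · have := h𝓑 hB; simp at this; exact this.1
  · have := h𝓑 hB; simp at this; exact this.2
  · by_contra! h0
    exact h'.2 (hmin.2 h0 h'.1)

/-- A good set `U` for the family without `B` must miss `B`, or it would be good for the whole
family. Adding `w` repairs `B`, so it must create a red critical set, which uses `w` and no other
vertex of `B`. -/
theorem IsObstruction.exists_red_inter_eq_singleton {𝓑 : Finset (Finset A)}
    (h : IsObstruction G μ m K 𝓑) {B : Finset A} (hB : B ∈ 𝓑) {w : A} (hw : w ∈ B) :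
    ∃ R, IsCritical G μ μ R ∧ R.card ≤ K ∧ R ⊆ 𝓑.biUnion id ∧ R ∩ B = {w} := by
  obtain ⟨U, hU⟩ := h.exists_good _ (Finset.erase_ssubset hB)
  have hU := hU.inter (V := 𝓑.biUnion id) fun B' hB' =>
    Finset.subset_biUnion_of_mem id (Finset.mem_of_mem_erase hB')
  set U' := U ∩ 𝓑.biUnion id
  have h0 : B ∩ U' = ∅ := by
    by_contra h0
    refine h.not_good U' ⟨fun B' hB' => ?_, hU.2⟩
    by_cases hBB : B' = B
    · rw [hBB]; exact Finset.nonempty_iff_ne_empty.2 h0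
    · exact hU.1 B' (Finset.mem_erase.2 ⟨hBB, hB'⟩)
  have h1 := h.not_good (insert w U')
  rw [IsGood, not_and] at h1
  have h2 := h1 (fun B' hB' => by
    by_cases hBB : B' = B
    · exact ⟨w, by simp [hBB, hw]⟩
    · exact (hU.1 B' (Finset.mem_erase.2 ⟨hBB, hB'⟩)).mono
        (Finset.inter_subset_inter_left (Finset.subset_insert _ _)))
  push Not at h2
  obtain ⟨R, hR, hRK, hRU⟩ := h2
  have hwR : w ∈ R := by
    by_contra hwR
    exact hU.2 R hR hRK ((Finset.subset_insert_iff_of_notMem hwR).1 hRU)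
  refine ⟨R, hR, hRK, fun x hx => ?_, ?_⟩
  · rcases Finset.mem_insert.1 (hRU hx) with rfl | hx'
    · exact Finset.subset_biUnion_of_mem id hB hw
    · exact (Finset.mem_inter.1 hx').2
  · ext x
    have := Finset.ext_iff.1 h0 x
    simp only [Finset.mem_inter, Finset.notMem_empty, iff_false, Finset.mem_singleton] at this ⊢
    constructor
    · rintro ⟨hxR, hxB⟩
      rcases Finset.mem_insert.1 (hRU hxR) with rfl | hx'
      · rfl
      · exact absurd ⟨hxB, hx'⟩ this
    · rintro rfl
      exact ⟨hwR, hw⟩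

/-- The blue sets inside `S` and those outside form two proper subfamilies, each with a good set.
The union of the two good sets is not good, so it contains a red set, which must use both sides.
Taking the outer good set minimal gives each of its vertices a private blue set. -/
theorem IsObstruction.exists_red_crossing {𝓑 : Finset (Finset A)}
    (h : IsObstruction G μ m K 𝓑) {S : Finset A} (hS : S.Nonempty) (hSV : S ⊂ 𝓑.biUnion id)
    (hcross : ∀ B ∈ 𝓑, B ⊆ S ∨ Disjoint B S) :
    ∃ R, IsCritical G μ μ R ∧ R.card ≤ K ∧ R ⊆ 𝓑.biUnion id ∧ (R ∩ S).Nonempty ∧ ¬ R ⊆ S ∧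
      ∀ u ∈ R \ S, ∃ B ∈ 𝓑, Disjoint B S ∧ B ∩ R = {u} := by
  classical
  set V := 𝓑.biUnion id with hV
  have hin : 𝓑.filter (· ⊆ S) ⊂ 𝓑 := by
    refine (Finset.filter_subset _ _).ssubset_of_ne fun h0 => hSV.2 ?_
    intro x hx
    obtain ⟨B, hB, hxB⟩ := Finset.mem_biUnion.1 hx
    rw [← h0] at hB
    exact (Finset.mem_filter.1 hB).2 hxB
  have hout : 𝓑.filter (Disjoint · S) ⊂ 𝓑 := by
    refine (Finset.filter_subset _ _).ssubset_of_ne fun h0 => ?_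
    obtain ⟨x, hx⟩ := hS
    obtain ⟨B, hB, hxB⟩ := Finset.mem_biUnion.1 (hSV.1 hx)
    rw [← h0] at hB
    exact Finset.disjoint_left.1 (Finset.mem_filter.1 hB).2 hxB hx
  obtain ⟨U₁, hU₁⟩ := h.exists_good _ hin
  obtain ⟨U₂, hU₂⟩ := h.exists_good _ hout
  have hU₁ := hU₁.inter (V := S) fun B hB => (Finset.mem_filter.1 hB).2
  have hU₂ := hU₂.inter (V := V \ S) fun B hB => by
    rw [Finset.mem_filter] at hB
    exact Finset.subset_sdiff.2 ⟨Finset.subset_biUnion_of_mem id hB.1, hB.2⟩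
  obtain ⟨U, hUsub, hU, hmin⟩ := exists_minimal_le_of_wellFoundedLT _ _ hU₂
  have hUsub : U ⊆ V \ S := hUsub.trans Finset.inter_subset_right
  have h1 := h.not_good (U₁ ∩ S ∪ U)
  rw [IsGood, not_and] at h1
  have h2 := h1 (fun B hB => by
    rcases hcross B hB with h2 | h2
    · exact (hU₁.1 B (Finset.mem_filter.2 ⟨hB, h2⟩)).mono
        (Finset.inter_subset_inter_left Finset.subset_union_left)
    · exact (hU.1 B (Finset.mem_filter.2 ⟨hB, h2⟩)).mono
        (Finset.inter_subset_inter_left Finset.subset_union_right))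
  push Not at h2
  obtain ⟨R, hR, hRK, hRU⟩ := h2
  have hRmem : ∀ x ∈ R, (x ∈ U₁ ∧ x ∈ S) ∨ x ∈ U := fun x hx => by
    simpa using hRU hx
  have hUmem : ∀ x ∈ U, x ∈ V ∧ x ∉ S := fun x hx => by simpa using hUsub hx
  refine ⟨R, hR, hRK, fun x hx => ?_, ?_, ?_, fun u hu => ?_⟩
  · rcases hRmem x hx with h3 | h3
    · exact hSV.1 h3.2
    · exact (hUmem x h3).1
  · by_contra h0
    rw [Finset.not_nonempty_iff_eq_empty] at h0
    refine hU.2 R hR hRK fun x hx => ?_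
    rcases hRmem x hx with h3 | h3
    · have : x ∈ R ∩ S := Finset.mem_inter.2 ⟨hx, h3.2⟩
      simp [h0] at this
    · exact h3
  · intro h0
    refine hU₁.2 R hR hRK fun x hx => ?_
    rcases hRmem x hx with h3 | h3
    · exact Finset.mem_inter.2 h3
    · exact absurd (h0 hx) (hUmem x h3).2
  · rw [Finset.mem_sdiff] at hu
    have huU : u ∈ U := (hRmem u hu.1).resolve_left fun h3 => hu.2 h3.2
    -- By minimality of `U`, some outer blue set is met by `U` only in `u`; being disjoint from `S`,
    -- it then meets `R` only in `u` as well.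
    have h3 : ¬ IsGood G μ K (𝓑.filter (Disjoint · S)) (U.erase u) := fun h3 =>
      Finset.notMem_erase u U (hmin h3 (Finset.erase_subset _ _) huU)
    have h4 : ∃ B ∈ 𝓑.filter (Disjoint · S), ¬ (B ∩ U.erase u).Nonempty := by
      by_contra! h4
      exact h3 (hU.mono (Finset.erase_subset _ _) h4)
    obtain ⟨B, hB, hBU⟩ := h4
    obtain ⟨y, hy⟩ := hU.1 B hB
    rw [Finset.not_nonempty_iff_eq_empty, Finset.eq_empty_iff_forall_notMem] at hBU
    simp only [Finset.mem_inter, Finset.mem_erase] at hBU hy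
    have hyu : y = u := by
      by_contra hyu
      exact hBU y ⟨hy.1, hyu, hy.2⟩
    rw [Finset.mem_filter] at hB
    refine ⟨B, hB.1, hB.2, ?_⟩
    ext x
    simp only [Finset.mem_inter, Finset.mem_singleton]
    constructor
    · rintro ⟨hxB, hxR⟩
      by_contra hxu
      rcases hRmem x hxR with h5 | h5
      · exact Finset.disjoint_left.1 hB.2 hxB h5.2
      · exact hBU x ⟨hxB, hxu, h5⟩
    · rintro rfl
      exact ⟨hyu ▸ hy.1, hu.1⟩

end
-- The union of an obstruction is explorable
section
variable {A : Type*} [Finite A] [DecidableEq A] {G : SimpleGraph A} {μ m : ℝ} {K : ℕ}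

theorem IsCritical.exists_ne_mem {a b : ℝ} {R : Finset A} (h : IsCritical G a b R) (w : A) :
    ∃ x ∈ R, x ≠ w := by
  obtain ⟨x, hx, y, hy, hxy⟩ := Finset.one_lt_card.1 h.1
  by_cases hxw : x = w
  · exact ⟨y, hy, fun h => hxy (hxw.trans h.symm)⟩
  · exact ⟨x, hx, hxw⟩

theorem disjoint_edgesIn {S T : Finset A} (h : (S ∩ T).card ≤ 1) :
    Disjoint (edgesIn G S) (edgesIn G T) := by
  rw [Finset.disjoint_iff_inter_eq_empty, ← edgesIn_inter, edgesIn_eq_empty_of_card_le_one h]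

theorem IsObstruction.nonempty {𝓑 : Finset (Finset A)} (h : IsObstruction G μ m K 𝓑) :
    (𝓑.biUnion id).Nonempty := by
  have h1 := h.not_good ∅
  rw [IsGood, not_and'] at h1
  have h2 := h1 fun R hR _ h0 => by
    have := hR.1
    rw [Finset.subset_empty.1 h0] at this
    simp at this
  push Not at h2
  obtain ⟨B, hB, -⟩ := h2
  obtain ⟨x, hx⟩ := Finset.card_pos.1 (lt_of_lt_of_le zero_lt_two (h.blue B hB).1)
  exact ⟨x, Finset.mem_biUnion.2 ⟨B, hB, hx⟩⟩

/-- A red set `R` crossing `S`, with blue sets `f u` glued on at its vertices outside `S`. -/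
structure IsGluing (G : SimpleGraph A) (μ m : ℝ) (S R : Finset A) (f : A → Finset A) : Prop where
  red : IsCritical G μ μ R
  inter_nonempty : (R ∩ S).Nonempty
  not_subset : ¬ R ⊆ S
  blue : ∀ u ∈ R \ S, IsCritical G m μ (f u)
  disjoint : ∀ u ∈ R \ S, Disjoint (f u) S
  inter_eq : ∀ u ∈ R \ S, f u ∩ R = {u}

theorem IsGluing.glued_sdiff {S R : Finset A} {f : A → Finset A} (h : IsGluing G μ m S R f)
    {T : Finset A} (hT : T ⊆ R \ S) :
    ((R ∪ T.biUnion f) \ S).card = (R \ S).card + ((R ∪ T.biUnion f) \ R).card := by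
  rw [← Finset.card_union_of_disjoint]
  · congr 1
    ext x
    have : x ∈ T.biUnion f → x ∉ S := by
      rintro hx hxS
      obtain ⟨u, hu, hxu⟩ := Finset.mem_biUnion.1 hx
      exact Finset.disjoint_left.1 (h.disjoint u (hT hu)) hxu hxS
    simp only [Finset.mem_sdiff, Finset.mem_union]
    tauto
  · rw [Finset.disjoint_left]
    simp only [Finset.mem_sdiff]
    tauto

theorem IsGluing.edges_subset {S R : Finset A} {f : A → Finset A} (h : IsGluing G μ m S R f)
    {T : Finset A} (hT : T ⊆ R \ S) :
    ((edgesIn G R \ edgesIn G S) ∪ T.biUnion fun u => edgesIn G (f u)) ⊆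
      edgesIn G (R ∪ T.biUnion f) \ edgesIn G S := by
  intro e he
  simp only [Finset.mem_union, Finset.mem_sdiff, Finset.mem_biUnion] at he ⊢
  rcases he with ⟨h1, h2⟩ | ⟨u, hu, h1⟩
  · exact ⟨edgesIn_mono Finset.subset_union_left h1, h2⟩
  · refine ⟨edgesIn_mono ((Finset.subset_biUnion_of_mem f hu).trans
      Finset.subset_union_right) h1, ?_⟩
    refine Finset.disjoint_left.1 (disjoint_edgesIn ?_) h1
    rw [Finset.disjoint_iff_inter_eq_empty.1 (h.disjoint u (hT hu))]
    simp

theorem IsObstruction.exists_isGluing {𝓑 : Finset (Finset A)} (h : IsObstruction G μ m K 𝓑)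
    {S : Finset A} (hS : S.Nonempty) (hSV : S ⊂ 𝓑.biUnion id)
    (hcross : ∀ B ∈ 𝓑, B ⊆ S ∨ Disjoint B S) :
    ∃ R f, IsGluing G μ m S R f ∧ R.card ≤ K ∧ R ⊆ 𝓑.biUnion id ∧ ∀ u ∈ R \ S, f u ∈ 𝓑 := by
  obtain ⟨R, h1, h2, h3, h4, h5, h6⟩ := h.exists_red_crossing hS hSV hcross
  choose! f hf using h6
  exact ⟨R, f, ⟨h1, h4, h5, fun u hu => h.blue _ (hf u hu).1, fun u hu => (hf u hu).2.1,
    fun u hu => (hf u hu).2.2⟩, h2, h3, fun u hu => (hf u hu).1⟩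

theorem IsGluing.le_card (hμ : 0 ≤ μ) (hμm : μ ≤ m) {S R : Finset A} {f : A → Finset A}
    (h : IsGluing G μ m S R f) {T : Finset A} (hT : T ⊆ R \ S) :
    (edgesIn G R \ edgesIn G S).card + T.card * (m - μ) + m * ((R ∪ T.biUnion f) \ R).card ≤
      (((edgesIn G R \ edgesIn G S) ∪ T.biUnion fun u => edgesIn G (f u)).card : ℝ) :=
  le_card_edges_glued hμ hμm (hT.trans Finset.sdiff_subset)
    fun u hu => ⟨h.blue u (hT hu), h.inter_eq u (hT hu)⟩

/-- The red set gains about `μ` edges per vertex outside `S`, and the blue set glued on there adds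
the missing `m - μ`. The bracket keeps the surplus of the red set, needed for strictness. -/
theorem IsGluing.le_card_sdiff (hμ : 0 ≤ μ) (hμm : μ ≤ m) {S R : Finset A} {f : A → Finset A}
    (h : IsGluing G μ m S R f) :
    m * ((R ∪ (R \ S).biUnion f) \ S).card + ((edgesIn G R \ edgesIn G S).card
      - μ * (R \ S).card) ≤
      (edgesIn G (R ∪ (R \ S).biUnion f) \ edgesIn G S).card := by
  have h1 := h.le_card hμ hμm subset_rfl
  have h2 : (((edgesIn G R \ edgesIn G S) ∪ (R \ S).biUnion fun u => edgesIn G (f u)).card : ℝ) ≤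
    (edgesIn G (R ∪ (R \ S).biUnion f) \ edgesIn G S).card := by
    exact_mod_cast Finset.card_le_card (h.edges_subset subset_rfl)
  rw [h.glued_sdiff subset_rfl]
  push_cast
  linarith

/-- If a blue set crosses the boundary of `S`, it is the step; otherwise a crossing red set with its
glued blue sets is, which accounts for the size `K + K * K`. One common vertex with `S` gives the
first alternative, more give the strict one. -/
theorem IsObstruction.exists_step (hμ : 0 ≤ μ) (hμm : μ ≤ m) {𝓑 : Finset (Finset A)}
    (h : IsObstruction G μ m K 𝓑) {S : Finset A} (hS : S.Nonempty) (hSV : S ⊂ 𝓑.biUnion id) :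
    ∃ B : Finset A, B ⊆ 𝓑.biUnion id ∧ B.card ≤ K + K * K ∧ ¬ B ⊆ S ∧
    (((B ∩ S).card = 1 ∧ m * (B \ S).card ≤ (edgesIn G B).card) ∨
      m * (B \ S).card + (edgesIn G (B ∩ S)).card < (edgesIn G B).card) := by
  by_cases hcross : ∀ B ∈ 𝓑, B ⊆ S ∨ Disjoint B S
  · obtain ⟨R, f, hg, hRK, hRV, hf⟩ := h.exists_isGluing hS hSV hcross
    have h1 := hg.le_card_sdiff hμ hμm
    set W := R ∪ (R \ S).biUnion f with hW
    have h2 := card_edgesIn_sdiff (G := G) W S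
    have h3 := hg.red.le_card_sdiff le_rfl hg.inter_nonempty
    have h4 : W ∩ S = R ∩ S := by
      ext x
      have : x ∈ (R \ S).biUnion f → x ∉ S := by
        rintro hx hxS
        obtain ⟨u, hu, hxu⟩ := Finset.mem_biUnion.1 hx
        exact Finset.disjoint_left.1 (hg.disjoint u hu) hxu hxS
      simp only [hW, Finset.mem_inter, Finset.mem_union]
      tauto
    refine ⟨W, ?_, ?_, fun h0 => hg.not_subset (Finset.subset_union_left.trans h0), ?_⟩
    · refine Finset.union_subset hRV (Finset.biUnion_subset.2 fun u hu => ?_)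
      exact Finset.subset_biUnion_of_mem id (hf u hu)
    · refine (Finset.card_union_le _ _).trans (add_le_add hRK ?_)
      refine (Finset.card_biUnion_le_card_mul _ _ K fun u hu => h.card_le _ (hf u hu)).trans ?_
      exact Nat.mul_le_mul_right _ ((Finset.card_le_card Finset.sdiff_subset).trans hRK)
    · rcases Nat.lt_or_ge (R ∩ S).card 2 with h5 | h5
      · left
        have h6 : (W ∩ S).card = 1 := by
          rw [h4]
          have := hg.inter_nonempty.card_pos
          omega
        refine ⟨h6, ?_⟩
        rw [edgesIn_eq_empty_of_card_le_one h6.le, Finset.card_empty, Nat.cast_zero,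
          add_zero] at h2
        linarith
      · right
        have := hg.red.lt_card_sdiff h5 hg.not_subset
        linarith
  · push Not at hcross
    obtain ⟨B, hB, hBS, hBd⟩ := hcross
    have hne : (B ∩ S).Nonempty := by
      rw [Finset.nonempty_iff_ne_empty]
      exact fun h0 => hBd (Finset.disjoint_iff_inter_eq_empty.2 h0)
    refine ⟨B, Finset.subset_biUnion_of_mem id hB, (h.card_le B hB).trans (Nat.le_add_right _ _),
      hBS, ?_⟩
    have h2 := card_edgesIn_sdiff (G := G) B S
    rcases Nat.lt_or_ge (B ∩ S).card 2 with h5 | h5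
    · left
      have h6 : (B ∩ S).card = 1 := by
        have := hne.card_pos
        omega
      have := (h.blue B hB).le_card_sdiff hμm hne
      rw [edgesIn_eq_empty_of_card_le_one h6.le, Finset.card_empty, Nat.cast_zero,
        add_zero] at h2
      exact ⟨h6, by linarith⟩
    · right
      have := (h.blue B hB).lt_card_sdiff h5 hBS
      linarith

/-- `S` minimises the deficit m|S| - e(S) over nonempty proper subsets and is largest among the
minimisers. A blue set is a competitor of deficit at most `μ`; an extension of density at least `m`
can only end at the full union. -/
theorem IsObstruction.exists_extremal {𝓑 : Finset (Finset A)}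
    (h : IsObstruction G μ m K 𝓑) :
    ∃ S : Finset A, S.Nonempty ∧ S ⊂ 𝓑.biUnion id ∧ m * S.card - (edgesIn G S).card ≤ μ ∧
      ∀ S', S ⊂ S' → S' ⊆ 𝓑.biUnion id →
        m * (S' \ S).card ≤ (edgesIn G S' \ edgesIn G S).card → S' = 𝓑.biUnion id := by
  classical
  set V := 𝓑.biUnion id with hV
  set Λ : Finset A → ℝ := fun S => m * S.card - (edgesIn G S).card with hΛ
  set C := V.ssubsets.filter (·.Nonempty) with hC
  have hmemC : ∀ S, S ∈ C ↔ S ⊂ V ∧ S.Nonempty := by simp [hC]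
  obtain ⟨v, hv⟩ := h.nonempty
  obtain ⟨B, hB, hvB⟩ := Finset.mem_biUnion.1 hv
  -- A blue set is not the whole union: a red set inside the union meets it in one vertex, yet has
  -- at least two.
  have hBC : B ∈ C := by
    refine (hmemC B).2 ⟨(Finset.subset_biUnion_of_mem id hB).ssubset_of_ne ?_, v, hvB⟩
    rintro (h0 : B = V)
    obtain ⟨R, h1, -, h2, h3⟩ := h.exists_red_inter_eq_singleton hB (w := v) hvB
    rw [h0, Finset.inter_eq_left.2 h2] at h3
    have := h1.1
    rw [h3] at this
    simp at this
  obtain ⟨S₀, hS₀, hmin⟩ := C.exists_min_image Λ ⟨B, hBC⟩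
  obtain ⟨S, hS, hmax⟩ := (C.filter fun S => Λ S ≤ Λ S₀).exists_max_image Finset.card
    ⟨S₀, by simp [hS₀]⟩
  rw [Finset.mem_filter] at hS
  refine ⟨S, ((hmemC S).1 hS.1).2, ((hmemC S).1 hS.1).1, ?_, fun S' hSS' hS'V hle => ?_⟩
  · have := (h.blue B hB).2.1
    have := hmin B hBC
    have := hS.2
    simp only [hΛ] at *
    linarith
  · by_contra hne
    have hS'C : S' ∈ C := (hmemC S').2 ⟨hS'V.ssubset_of_ne hne,
      ((hmemC S).1 hS.1).2.mono hSS'.1⟩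
    have h1 := hmax S' (Finset.mem_filter.2 ⟨hS'C, by
      refine le_trans ?_ hS.2
      have h2 := card_edgesIn_sdiff (G := G) S' S
      rw [Finset.inter_eq_right.2 hSS'.1] at h2
      have h3 := Finset.card_sdiff_add_card_inter S' S
      rw [Finset.inter_eq_right.2 hSS'.1] at h3
      have h4 : ((S' \ S).card : ℝ) + S.card = S'.card := by exact_mod_cast h3
      simp only [hΛ]
      rw [← h2, ← h4]
      linarith⟩)
    have h2 := Finset.card_lt_card hSS'
    omega

/-- An extremal `S` lacks at most `μ` edges, and one exploration step from it already reaches the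
whole union. The missing `μ` comes from an extra overlap of the last blue set, or from a red set
through one of its new vertices, whose edges have not been counted. -/
theorem IsObstruction.le_card_edgesIn (hμ : 0 < μ) (hμm : μ ≤ m) {𝓑 : Finset (Finset A)}
    (h : IsObstruction G μ m K 𝓑) :
    m * (𝓑.biUnion id).card ≤ (edgesIn G (𝓑.biUnion id)).card := by
  obtain ⟨S, hS, hSV, hSμ, hext⟩ := h.exists_extremal
  set V := 𝓑.biUnion id with hV
  -- it suffices to gain an additional `μ` on the way from `S` to `V`
  suffices hgain : ∃ Z ⊆ edgesIn G V \ edgesIn G S, m * (V \ S).card + μ ≤ Z.card by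
    obtain ⟨Z, hZ, hZm⟩ := hgain
    have h1 : (Z.card : ℝ) ≤ (edgesIn G V \ edgesIn G S).card := by
      exact_mod_cast Finset.card_le_card hZ
    have h2 := card_edgesIn_sdiff (G := G) V S
    have h3 := Finset.card_sdiff_add_card_inter V S
    rw [Finset.inter_eq_right.2 hSV.1] at h2 h3
    have h4 : ((V \ S).card : ℝ) + S.card = V.card := by exact_mod_cast h3
    rw [← h2, ← h4]
    linarith
  by_cases hcross : ∀ B ∈ 𝓑, B ⊆ S ∨ Disjoint B S
  · obtain ⟨R, f, hg, hRK, hRV, hf⟩ := h.exists_isGluing hS hSV hcross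
    obtain ⟨u, huR, huS⟩ := Finset.not_subset.1 hg.not_subset
    have huN : u ∈ R \ S := Finset.mem_sdiff.2 ⟨huR, huS⟩
    have h1 := hg.le_card_sdiff hμ.le hμm
    have h3 := hg.red.le_card_sdiff le_rfl hg.inter_nonempty
    set N := R \ S with hN
    -- One glued set `f u` is held back and added last, to extract the additional `μ`.
    set T := N.erase u with hT
    have hTN : T ⊆ N := Finset.erase_subset _ _
    set W := R ∪ T.biUnion f with hW
    set Y := (edgesIn G R \ edgesIn G S) ∪ T.biUnion fun u => edgesIn G (f u) with hY
    have hYm := hg.le_card hμ.le hμm hTN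
    have hYsub := hg.edges_subset hTN
    have hWS := hg.glued_sdiff hTN
    rw [← hW, ← hY] at hYm
    rw [← hW, ← hY] at hYsub
    rw [← hW] at hWS
    have hWW : R ∪ N.biUnion f = W ∪ f u := by
      rw [← Finset.insert_erase huN, Finset.biUnion_insert, hW, ← hT]
      ext x
      simp only [Finset.mem_union]
      tauto
    have huf : u ∈ f u := by
      have : u ∈ f u ∩ R := by rw [hg.inter_eq u huN]; simp
      exact (Finset.mem_inter.1 this).1
    have huW : u ∈ W := Finset.mem_union_left _ huR
    have hWV : W ∪ f u ⊆ V := by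
      rw [← hWW]
      refine Finset.union_subset hRV (Finset.biUnion_subset.2 fun u hu => ?_)
      exact Finset.subset_biUnion_of_mem id (hf u hu)
    have hVeq : S ∪ (W ∪ f u) = V := by
      refine hext _ ?_ (Finset.union_subset hSV.1 hWV) ?_
      · refine Finset.ssubset_iff_subset_ne.2 ⟨Finset.subset_union_left, fun h0 => huS ?_⟩
        rw [h0]
        simp [huf]
      · rw [Finset.union_sdiff_left, ← hWW]
        have h4 : ((edgesIn G (R ∪ N.biUnion f) \ edgesIn G S).card : ℝ) ≤
            (edgesIn G (S ∪ (R ∪ N.biUnion f)) \ edgesIn G S).card := by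
          exact_mod_cast Finset.card_le_card
            (Finset.sdiff_subset_sdiff (edgesIn_mono Finset.subset_union_right) le_rfl)
        linarith
    have hVS : (V \ S).card = N.card + (W \ R).card + (f u \ W).card := by
      rw [← hVeq, Finset.union_sdiff_left, ← hWS, ← Finset.card_union_of_disjoint]
      · congr 1
        ext x
        have : x ∈ f u → x ∉ S := fun hx => Finset.disjoint_left.1 (hg.disjoint u huN) hx
        simp only [Finset.mem_sdiff, Finset.mem_union]
        tauto
      · rw [Finset.disjoint_left]
        simp only [Finset.mem_sdiff]
        tauto
    have hTcard : (T.card : ℝ) + 1 = N.card := by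
      exact_mod_cast Finset.card_erase_add_one huN
    have hfY : ((edgesIn G (f u) \ edgesIn G (W.erase u)).card : ℝ) ≤
        (edgesIn G (f u) \ Y).card := by
      have := edgesIn_inter_subset_erase (G := G) (S := S) (W := W) Finset.subset_union_right
        (Finset.notMem_erase u N) (fun t ht => hg.inter_eq t (hTN ht)) (hg.inter_eq u huN)
      refine Nat.cast_le.2 (Finset.card_le_card fun e he => ?_)
      rw [Finset.mem_sdiff] at he ⊢
      exact ⟨he.1, fun h => he.2 (this (Finset.mem_inter.2 ⟨he.1, h⟩))⟩
    have hYV : Y ⊆ edgesIn G V \ edgesIn G S := hYsub.trans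
      (Finset.sdiff_subset_sdiff (edgesIn_mono (Finset.subset_union_left.trans hWV)) le_rfl)
    have hfV : edgesIn G (f u) \ Y ⊆ edgesIn G V \ edgesIn G S := by
      intro e he
      rw [Finset.mem_sdiff] at he ⊢
      refine ⟨edgesIn_mono (Finset.subset_union_right.trans hWV) he.1, ?_⟩
      refine Finset.disjoint_left.1 (disjoint_edgesIn ?_) he.1
      rw [Finset.disjoint_iff_inter_eq_empty.1 (hg.disjoint u huN)]
      simp
    have hYf : (Y ∪ (edgesIn G (f u) \ Y)).card = Y.card + (edgesIn G (f u) \ Y).card :=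
      Finset.card_union_of_disjoint Finset.disjoint_sdiff
    rw [hVS]
    -- If `f u` adds no vertex, it meets `W` also off `u` and its loss of `μ` is saved; otherwise a
    -- new vertex `w` carries a red set `Q`.
    by_cases hsub : f u ⊆ W
    · refine ⟨Y ∪ (edgesIn G (f u) \ Y), Finset.union_subset hYV hfV, ?_⟩
      have hne : (f u ∩ W.erase u).Nonempty := by
        obtain ⟨x, hx, hxu⟩ := (hg.blue u huN).exists_ne_mem u
        exact ⟨x, by simp [hx, hxu, hsub hx]⟩
      have h5 := (hg.blue u huN).le_card_sdiff_erase_of_nonempty hμm huf huW hne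
      rw [hYf]
      push_cast
      rw [← hTcard] at h3 ⊢
      linarith
    · obtain ⟨w, hwf, hwW⟩ := Finset.not_subset.1 hsub
      obtain ⟨Q, hQ, -, hQV, hQf⟩ := h.exists_red_inter_eq_singleton (hf u huN) hwf
      have hwS : w ∉ S := Finset.disjoint_left.1 (hg.disjoint u huN) hwf
      have hwQ : w ∈ Q := by
        have : w ∈ Q ∩ f u := by rw [hQf]; simp
        exact (Finset.mem_inter.1 this).1
      -- `Q` lies in the union and meets `f u` only in `w`, so its other vertices are in `S ∪ W`;
      -- hence it brings at least `μ` edges.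
      have hQne : (Q ∩ (S ∪ W)).Nonempty := by
        obtain ⟨x, hx, hxw⟩ := hQ.exists_ne_mem w
        have hxV : x ∈ V := hQV hx
        rw [← hVeq] at hxV
        have : x ∉ f u := fun hxf => hxw (by
          have : x ∈ Q ∩ f u := Finset.mem_inter.2 ⟨hx, hxf⟩
          rwa [hQf, Finset.mem_singleton] at this)
        refine ⟨x, ?_⟩
        simp only [Finset.mem_union, Finset.mem_inter] at hxV ⊢
        tauto
      have h6 := hQ.le_card_sdiff le_rfl hQne
      have h7 : (1 : ℝ) ≤ (Q \ (S ∪ W)).card := by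
        rw [Nat.one_le_cast, Nat.one_le_iff_ne_zero, Finset.card_ne_zero]
        exact ⟨w, by simp [hwQ, hwS, hwW]⟩
      have h8 : μ ≤ (edgesIn G Q \ edgesIn G (S ∪ W)).card := by nlinarith
      have h9 : m * ((f u \ W).card + 1) - μ ≤
          (edgesIn G (f u) \ edgesIn G (W.erase u)).card := by
        rcases (hg.blue u huN).le_card_sdiff_erase huf huW with h | h
        · exact h
        · linarith [(hg.blue u huN).le_card_sdiff_erase_of_nonempty hμm huf huW h]
      refine ⟨(Y ∪ (edgesIn G (f u) \ Y)) ∪ (edgesIn G Q \ edgesIn G (S ∪ W)),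
        Finset.union_subset (Finset.union_subset hYV hfV) ?_, ?_⟩
      · exact Finset.sdiff_subset_sdiff (edgesIn_mono hQV) (edgesIn_mono Finset.subset_union_left)
      · rw [Finset.card_union_of_disjoint, hYf]
        · push_cast
          rw [← hTcard] at h3 ⊢
          linarith
        · rw [Finset.disjoint_left]
          intro e he heQ
          rw [Finset.mem_sdiff] at heQ
          rw [Finset.mem_union, Finset.mem_sdiff] at he
          rcases he with he | he
          · exact heQ.2 (edgesIn_mono Finset.subset_union_right
              (Finset.mem_sdiff.1 (hYsub he)).1)
          · refine Finset.disjoint_left.1 (disjoint_edgesIn ?_) heQ.1 he.1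
            rw [hQf]
            simp
  · push Not at hcross
    obtain ⟨B, hB, hBS, hBd⟩ := hcross
    have hne : (B ∩ S).Nonempty := by
      rw [Finset.nonempty_iff_ne_empty]
      exact fun h0 => hBd (Finset.disjoint_iff_inter_eq_empty.2 h0)
    obtain ⟨w, hwB, hwS⟩ := Finset.not_subset.1 hBS
    have h1 := (h.blue B hB).le_card_sdiff hμm hne
    have hBV : B ⊆ V := Finset.subset_biUnion_of_mem id hB
    have hVeq : S ∪ B = V := by
      refine hext _ ?_ (Finset.union_subset hSV.1 hBV) ?_
      · refine Finset.ssubset_iff_subset_ne.2 ⟨Finset.subset_union_left, fun h0 => hwS ?_⟩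
        rw [h0]
        simp [hwB]
      · rw [Finset.union_sdiff_left]
        have h4 : ((edgesIn G B \ edgesIn G S).card : ℝ) ≤
            (edgesIn G (S ∪ B) \ edgesIn G S).card := by
          exact_mod_cast Finset.card_le_card
            (Finset.sdiff_subset_sdiff (edgesIn_mono Finset.subset_union_right) le_rfl)
        linarith
    obtain ⟨Q, hQ, -, hQV, hQf⟩ := h.exists_red_inter_eq_singleton hB hwB
    have hwQ : w ∈ Q := by
      have : w ∈ Q ∩ B := by rw [hQf]; simp
      exact (Finset.mem_inter.1 this).1
    have hQne : (Q ∩ S).Nonempty := by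
      obtain ⟨x, hx, hxw⟩ := hQ.exists_ne_mem w
      have hxV : x ∈ V := hQV hx
      rw [← hVeq] at hxV
      have : x ∉ B := fun hxf => hxw (by
        have : x ∈ Q ∩ B := Finset.mem_inter.2 ⟨hx, hxf⟩
        rwa [hQf, Finset.mem_singleton] at this)
      refine ⟨x, ?_⟩
      simp only [Finset.mem_union, Finset.mem_inter] at hxV ⊢
      tauto
    have h6 := hQ.le_card_sdiff le_rfl hQne
    have h7 : (1 : ℝ) ≤ (Q \ S).card := by
      rw [Nat.one_le_cast, Nat.one_le_iff_ne_zero, Finset.card_ne_zero]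
      exact ⟨w, by simp [hwQ, hwS]⟩
    have h8 : μ ≤ (edgesIn G Q \ edgesIn G S).card := by nlinarith
    have hVS : V \ S = B \ S := by rw [← hVeq, Finset.union_sdiff_left]
    refine ⟨(edgesIn G B \ edgesIn G S) ∪ (edgesIn G Q \ edgesIn G S),
      Finset.union_subset (Finset.sdiff_subset_sdiff (edgesIn_mono hBV) le_rfl)
        (Finset.sdiff_subset_sdiff (edgesIn_mono hQV) le_rfl), ?_⟩
    rw [Finset.card_union_of_disjoint, hVS]
    · push_cast
      linarith
    · refine (disjoint_edgesIn ?_).mono Finset.sdiff_subset Finset.sdiff_subset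
      rw [Finset.inter_comm, hQf]
      simp

/-- If every vertex set meeting all the blue critical sets contains a red critical set, then the
graph has an explorable vertex set. -/
theorem exists_explorable (hμ : 0 < μ) (hμm : μ ≤ m)
    (h : ∀ U : Finset A, (∀ B, IsCritical G m μ B → B.card ≤ K → (B ∩ U).Nonempty) →
      ∃ R, IsCritical G μ μ R ∧ R.card ≤ K ∧ R ⊆ U) :
    ∃ V, Explorable G m (K + K * K) V := by
  obtain ⟨𝓑, h𝓑⟩ := exists_isObstruction h
  exact ⟨_, h𝓑.nonempty, h𝓑.le_card_edgesIn hμ hμm, fun S hS hSV =>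
    h𝓑.exists_step hμ.le hμm hS hSV⟩
end

/-! ### Encoding explorations and counting the encodings -/

/-- The record of an exploration: the vertices `0, …, size - 1` found so far, the edges seen, a
pointer below which all vertices are exhausted, and the number of dense steps. -/
structure Sketch where
  size : ℕ
  edges : Finset (Sym2 ℕ)
  ptr : ℕ
  dense : ℕ

open scoped Classical in
/-- Gluing a set of at most `K` new vertices on at one vertex, at or after the pointer. -/
noncomputable def Sketch.treeSteps (K : ℕ) (σ : Sketch) : Finset Sketch :=
  (Finset.Ico σ.ptr σ.size ×ˢ Finset.range (K + 1)).biUnion fun q =>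
    (insert q.1 (Finset.Ico σ.size (σ.size + q.2))).sym2.powerset.image fun P =>
      ⟨σ.size + q.2, σ.edges ∪ P, q.1, σ.dense⟩

open scoped Classical in
/-- Adding at most `K` vertices and at most `M` arbitrary edges. -/
noncomputable def Sketch.denseSteps (K M : ℕ) (σ : Sketch) : Finset Sketch :=
  (Finset.range (K + 1) ×ˢ Finset.range (M + 1)).biUnion fun q =>
    ((Finset.range (σ.size + q.1)).sym2.powersetCard q.2).image fun P =>
      ⟨σ.size + q.1, σ.edges ∪ P, σ.ptr, σ.dense + 1⟩

open scoped Classical in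
/-- The sketches of explorations with `L` steps. -/
noncomputable def sketches (K M : ℕ) : ℕ → Finset Sketch
  | 0 => {⟨1, ∅, 0, 0⟩}
  | L + 1 => (sketches K M L).biUnion fun σ => σ.treeSteps K ∪ σ.denseSteps K M

theorem sum_biUnion_le_sum {ι α : Type*} [DecidableEq α] (s : Finset ι) (g : ι → Finset α)
    (f : α → ℝ) (hf : ∀ x, 0 ≤ f x) :
    ∑ x ∈ s.biUnion g, f x ≤ ∑ a ∈ s, ∑ x ∈ g a, f x := by
  classical
  induction s using Finset.induction_on with
  | empty => simp
  | insert a s ha ih =>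
    rw [Finset.biUnion_insert, Finset.sum_insert ha]
    have := Finset.sum_union_inter (s₁ := g a) (s₂ := s.biUnion g) (f := f)
    have := Finset.sum_nonneg (s := g a ∩ s.biUnion g) (f := f) fun x _ => hf x
    linarith

theorem sum_image_le_card_mul {ι α : Type*} [DecidableEq α] (s : Finset ι) (g : ι → α)
    (f : α → ℝ) {c : ℝ} (hc : 0 ≤ c) (hf : ∀ a ∈ s, f (g a) ≤ c) :
    ∑ x ∈ s.image g, f x ≤ s.card * c := by
  refine (Finset.sum_le_card_nsmul _ _ c fun x hx => ?_).trans ?_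
  · obtain ⟨a, ha, rfl⟩ := Finset.mem_image.1 hx
    exact hf a ha
  · rw [nsmul_eq_mul]
    exact mul_le_mul_of_nonneg_right (by exact_mod_cast Finset.card_image_le) hc

theorem sum_Ico_half_pow_le (a b : ℕ) :
    ∑ i ∈ Finset.Ico a b, (1 / 2 : ℝ) ^ i ≤ 2 * (1 / 2) ^ a := by
  rcases le_total b a with h | h
  · rw [Finset.Ico_eq_empty_of_le h]; simp
  · rw [geom_sum_Ico (by norm_num) h]
    have h1 : (0 : ℝ) < (1 / 2) ^ b := by positivity
    rw [show (1 / 2 - 1 : ℝ) = -(1 / 2) by norm_num, div_neg, ← neg_div, div_le_iff₀ (by norm_num)]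
    linarith

/-- The weight of a sketch. -/
noncomputable def Sketch.weight (y : ℝ) (σ : Sketch) : ℝ := (1 / 2) ^ σ.ptr * y ^ σ.dense

theorem Sketch.weight_nonneg {y : ℝ} (hy : 0 ≤ y) (σ : Sketch) : 0 ≤ σ.weight y := by
  unfold Sketch.weight; positivity

/-- The factor `(1 / 2) ^ ptr` makes the choice of the next pointer a geometric series, so a tree
step costs a constant however many vertices are present. -/
theorem Sketch.sum_treeSteps_le {y : ℝ} (hy : 0 ≤ y) (K : ℕ) (σ : Sketch) :
    ∑ τ ∈ σ.treeSteps K, τ.weight y ≤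
      ((K + 1) * 2 ^ ((K + 2).choose 2) * 2) * σ.weight y := by
  classical
  refine (sum_biUnion_le_sum _ _ _ fun x => x.weight_nonneg hy).trans ?_
  have h1 : ∀ q ∈ Finset.Ico σ.ptr σ.size ×ˢ Finset.range (K + 1),
      ∑ τ ∈ ((insert q.1 (Finset.Ico σ.size (σ.size + q.2))).sym2.powerset.image fun P =>
        (⟨σ.size + q.2, σ.edges ∪ P, q.1, σ.dense⟩ : Sketch)), τ.weight y ≤
      2 ^ ((K + 2).choose 2) * ((1 / 2) ^ q.1 * y ^ σ.dense) := by
    intro q hq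
    rw [Finset.mem_product, Finset.mem_range] at hq
    have h0 : 0 ≤ (1 / 2 : ℝ) ^ q.1 * y ^ σ.dense := by positivity
    refine (sum_image_le_card_mul _ _ (Sketch.weight y) h0 fun a _ => le_rfl).trans ?_
    refine mul_le_mul_of_nonneg_right ?_ h0
    rw [Finset.card_powerset, Finset.card_sym2]
    have h2 : (insert q.1 (Finset.Ico σ.size (σ.size + q.2))).card ≤ K + 1 := by
      refine (Finset.card_insert_le _ _).trans ?_
      simp only [Nat.card_Ico]
      omega
    push_cast
    exact pow_le_pow_right₀ (by norm_num) (Nat.choose_le_choose 2 (by omega))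
  refine (Finset.sum_le_sum h1).trans ?_
  rw [Finset.sum_product]
  simp only [Finset.sum_const, Finset.card_range, nsmul_eq_mul, ← Finset.mul_sum,
    ← Finset.sum_mul]
  have h2 := sum_Ico_half_pow_le σ.ptr σ.size
  have h3 : 0 ≤ y ^ σ.dense := by positivity
  unfold Sketch.weight
  calc _ ≤ ((K + 1 : ℕ) : ℝ) * (2 ^ ((K + 2).choose 2) *
        ((2 * (1 / 2) ^ σ.ptr) * y ^ σ.dense)) := by gcongr
    _ = _ := by push_cast; ring

/-- A dense step has polynomially many choices in the current size; the additional factor `y` in the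
weight absorbs them. -/
theorem Sketch.sum_denseSteps_le {y : ℝ} (hy : 0 ≤ y) (K M : ℕ) (σ : Sketch)
    (hσ : (((σ.size + K + 1) ^ 2 + 1) ^ M : ℝ) * y ≤ 1) :
    ∑ τ ∈ σ.denseSteps K M, τ.weight y ≤ ((K + 1) * (M + 1)) * σ.weight y := by
  classical
  refine (sum_biUnion_le_sum _ _ _ fun x => x.weight_nonneg hy).trans ?_
  have h1 : ∀ q ∈ Finset.range (K + 1) ×ˢ Finset.range (M + 1),
      ∑ τ ∈ (((Finset.range (σ.size + q.1)).sym2.powersetCard q.2).image fun P =>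
        (⟨σ.size + q.1, σ.edges ∪ P, σ.ptr, σ.dense + 1⟩ : Sketch)), τ.weight y ≤
      σ.weight y := by
    intro q hq
    rw [Finset.mem_product, Finset.mem_range, Finset.mem_range] at hq
    have h0 : 0 ≤ (1 / 2 : ℝ) ^ σ.ptr * y ^ (σ.dense + 1) := by positivity
    refine (sum_image_le_card_mul _ _ (Sketch.weight y) h0 fun a _ => le_rfl).trans ?_
    rw [Finset.card_powersetCard, Finset.card_sym2, Finset.card_range]
    have h2 : (σ.size + q.1 + 1).choose 2 ≤ (σ.size + K + 1) ^ 2 + 1 :=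
      ((Nat.choose_le_pow _ _).trans (Nat.pow_le_pow_left (by omega) 2)).trans (Nat.le_succ _)
    have h3 : ((σ.size + q.1 + 1).choose 2).choose q.2 ≤ ((σ.size + K + 1) ^ 2 + 1) ^ M :=
      ((Nat.choose_le_pow _ _).trans (Nat.pow_le_pow_left h2 _)).trans
        (Nat.pow_le_pow_right (Nat.succ_pos _) (by omega))
    have h4 : (((σ.size + q.1 + 1).choose 2).choose q.2 : ℝ) ≤
        ((σ.size + K + 1) ^ 2 + 1) ^ M := by exact_mod_cast h3
    calc _ ≤ (((σ.size + K + 1) ^ 2 + 1) ^ M : ℝ) *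
          ((1 / 2 : ℝ) ^ σ.ptr * y ^ (σ.dense + 1)) := mul_le_mul_of_nonneg_right h4 h0
      _ = ((((σ.size + K + 1) ^ 2 + 1) ^ M : ℝ) * y) * σ.weight y := by
          unfold Sketch.weight; ring
      _ ≤ 1 * σ.weight y := mul_le_mul_of_nonneg_right hσ (σ.weight_nonneg hy)
      _ = _ := one_mul _
  refine (Finset.sum_le_sum h1).trans (le_of_eq ?_)
  simp

theorem mem_treeSteps {K : ℕ} {σ τ : Sketch} : τ ∈ σ.treeSteps K ↔
    ∃ t k P, σ.ptr ≤ t ∧ t < σ.size ∧ k ≤ K ∧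
      P ⊆ (insert t (Finset.Ico σ.size (σ.size + k))).sym2 ∧
      τ = ⟨σ.size + k, σ.edges ∪ P, t, σ.dense⟩ := by
  classical
  simp only [Sketch.treeSteps, Finset.mem_biUnion, Finset.mem_product, Finset.mem_Ico,
    Finset.mem_range, Finset.mem_image, Finset.mem_powerset, Prod.exists]
  constructor
  · rintro ⟨t, k, ⟨⟨h1, h2⟩, h3⟩, P, hP, rfl⟩
    exact ⟨t, k, P, h1, h2, by omega, by convert hP, by congr!⟩
  · rintro ⟨t, k, P, h1, h2, h3, hP, rfl⟩
    exact ⟨t, k, ⟨⟨h1, h2⟩, by omega⟩, P, by convert hP, by congr!⟩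

theorem mem_denseSteps {K M : ℕ} {σ τ : Sketch} : τ ∈ σ.denseSteps K M ↔
    ∃ k P, k ≤ K ∧ P.card ≤ M ∧ P ⊆ (Finset.range (σ.size + k)).sym2 ∧
      τ = ⟨σ.size + k, σ.edges ∪ P, σ.ptr, σ.dense + 1⟩ := by
  classical
  simp only [Sketch.denseSteps, Finset.mem_biUnion, Finset.mem_product,
    Finset.mem_range, Finset.mem_image, Finset.mem_powersetCard, Prod.exists]
  constructor
  · rintro ⟨k, j, ⟨h1, h2⟩, P, hP, rfl⟩
    exact ⟨k, P, by omega, by omega, hP.1, by congr!⟩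
  · rintro ⟨k, P, h1, h2, hP, rfl⟩
    exact ⟨k, P.card, ⟨by omega, by omega⟩, P, ⟨hP, rfl⟩, by congr!⟩

theorem mem_sketches_succ {K M L : ℕ} {τ : Sketch} : τ ∈ sketches K M (L + 1) ↔
    ∃ σ ∈ sketches K M L, τ ∈ σ.treeSteps K ∨ τ ∈ σ.denseSteps K M := by
  classical
  simp [sketches]

theorem size_le_of_mem_sketches {K M L : ℕ} {σ : Sketch} (h : σ ∈ sketches K M L) :
    σ.size ≤ 1 + K * L ∧ σ.ptr ≤ σ.size := by
  induction L generalizing σ with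
  | zero => simp [sketches] at h; simp [h]
  | succ L ih =>
    obtain ⟨ρ, hρ, hσ⟩ := mem_sketches_succ.1 h
    obtain ⟨h1, h2⟩ := ih hρ
    rw [mem_treeSteps, mem_denseSteps] at hσ
    rw [mul_add, mul_one]
    rcases hσ with ⟨t, k, P, h3, h4, h5, h6, rfl⟩ | ⟨k, P, h3, h4, h5, rfl⟩
    · simp only; omega
    · simp only; omega

theorem sum_sketches_le {y : ℝ} (hy : 0 ≤ y) (K M L : ℕ)
    (hyL : (((K * L + K + 2) ^ 2 + 1) ^ M : ℝ) * y ≤ 1) {i : ℕ} (hi : i ≤ L) :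
    ∑ σ ∈ sketches K M i, σ.weight y ≤
      ((K + 1) * 2 ^ ((K + 2).choose 2) * 2 + (K + 1) * (M + 1)) ^ i := by
  classical
  induction i with
  | zero => simp [sketches, Sketch.weight]
  | succ i ih =>
    rw [sketches]
    refine (sum_biUnion_le_sum _ _ _ fun x => x.weight_nonneg hy).trans ?_
    rw [pow_succ']
    refine le_trans ?_ (mul_le_mul_of_nonneg_left (ih (by omega)) (by positivity))
    rw [Finset.mul_sum]
    refine Finset.sum_le_sum fun σ hσ => ?_
    have h1 := Finset.sum_union_inter (s₁ := σ.treeSteps K) (s₂ := σ.denseSteps K M)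
      (f := fun τ => τ.weight y)
    have h2 := Finset.sum_nonneg (s := σ.treeSteps K ∩ σ.denseSteps K M)
      (f := fun τ => τ.weight y) fun x _ => x.weight_nonneg hy
    have h3 := σ.sum_treeSteps_le hy K
    have h4 := σ.sum_denseSteps_le hy K M (by
      refine le_trans (mul_le_mul_of_nonneg_right ?_ hy) hyL
      have h5 : σ.size + K + 1 ≤ K * L + K + 2 := by
        have := (size_le_of_mem_sketches hσ).1
        have : K * i ≤ K * L := Nat.mul_le_mul_left K (by omega)
        omega
      have h6 : (σ.size + K + 1 : ℝ) ≤ K * L + K + 2 := by exact_mod_cast h5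
      gcongr)
    linarith

/-- The number of sketches with `L` steps, boundedly many of them dense, is at most
exponential. -/
theorem exists_card_sketches_le (K M D : ℕ) : ∃ a : ℝ, 1 ≤ a ∧ ∀ L : ℕ,
    (((sketches K M L).filter fun σ => σ.dense ≤ D).card : ℝ) ≤ a ^ (L + 1) := by
  set C : ℝ := (K + 1) * 2 ^ ((K + 2).choose 2) * 2 + (K + 1) * (M + 1) with hC
  have hC1 : 1 ≤ C := by
    have h1 : (1 : ℝ) ≤ (K + 1) * (M + 1) := by
      exact_mod_cast Nat.succ_le_of_lt (Nat.mul_pos (Nat.succ_pos K) (Nat.succ_pos M))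
    have h2 : (0 : ℝ) ≤ (K + 1) * 2 ^ ((K + 2).choose 2) * 2 := by positivity
    linarith
  -- `C` is the growth of the total weight per step; the other factors undo the least possible
  -- weight of a single sketch, from its pointer and its at most `D` dense steps.
  refine ⟨C * 2 ^ (K + 1) * 4 ^ ((K + 2) * M * D), ?_, fun L => ?_⟩
  · have h1 : (1 : ℝ) ≤ 2 ^ (K + 1) := one_le_pow₀ (by norm_num)
    have h2 : (1 : ℝ) ≤ 4 ^ ((K + 2) * M * D) := one_le_pow₀ (by norm_num)
    exact one_le_mul_of_one_le_of_one_le (one_le_mul_of_one_le_of_one_le hC1 h1) h2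
  -- `z` bounds the choices of edge set of a dense step at any time, so `y = z⁻¹` is admissible.
  · set z : ℝ := ((K * L + K + 2) ^ 2 + 1) ^ M with hz
    have hz1 : 1 ≤ z := one_le_pow₀ (by nlinarith [sq_nonneg ((K : ℝ) * L + K + 2)])
    have hzle : z ≤ 4 ^ ((K + 2) * M * (L + 1)) := by
      have h1 : K * L + K + 2 ≤ (K + 2) * (L + 1) := by ring_nf; omega
      have h2 : (K * L + K + 2) ^ 2 + 1 ≤ 4 ^ ((K + 2) * (L + 1)) := by
        set x := (K + 2) * (L + 1)
        have h3 : x + 1 ≤ 2 ^ x := Nat.lt_two_pow_self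
        calc (K * L + K + 2) ^ 2 + 1 ≤ x ^ 2 + 1 := by gcongr
          _ ≤ (x + 1) ^ 2 := by ring_nf; omega
          _ ≤ (2 ^ x) ^ 2 := Nat.pow_le_pow_left h3 2
          _ = 4 ^ x := by rw [← pow_mul, mul_comm, pow_mul]; norm_num
      calc z ≤ (4 ^ ((K + 2) * (L + 1))) ^ M := by
            rw [hz]
            refine pow_le_pow_left₀ (by positivity) ?_ M
            exact_mod_cast h2
        _ = _ := by rw [← pow_mul]; congr 1; ring
    have hsum := sum_sketches_le (y := z⁻¹) (by positivity) K M L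
      (by rw [← hz]; exact (mul_inv_cancel₀ (by positivity)).le) le_rfl
    have hw : ∀ σ ∈ (sketches K M L).filter fun σ => σ.dense ≤ D,
        (1 / 2 : ℝ) ^ (1 + K * L) * z⁻¹ ^ D ≤ σ.weight z⁻¹ := by
      intro σ hσ
      rw [Finset.mem_filter] at hσ
      have h1 := size_le_of_mem_sketches hσ.1
      refine mul_le_mul (pow_le_pow_of_le_one (by norm_num) (by norm_num) (h1.2.trans h1.1))
        (pow_le_pow_of_le_one (by positivity) (inv_le_one_of_one_le₀ hz1) hσ.2)
        (by positivity) (by positivity)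
    have h1 := Finset.card_nsmul_le_sum _ _ _ hw
    have h2 := Finset.sum_le_sum_of_subset_of_nonneg (f := fun σ => Sketch.weight z⁻¹ σ)
      (Finset.filter_subset (fun σ => σ.dense ≤ D) (sketches K M L))
      fun σ _ _ => σ.weight_nonneg (by positivity)
    have h3 := (h1.trans h2).trans hsum
    rw [nsmul_eq_mul] at h3
    set N : ℝ := (((sketches K M L).filter fun σ => σ.dense ≤ D).card : ℝ)
    have h4 : N ≤ C ^ L * (2 ^ (1 + K * L) * z ^ D) := by
      have h5 : N * ((1 / 2 : ℝ) ^ (1 + K * L) * z⁻¹ ^ D) * (2 ^ (1 + K * L) * z ^ D) = N := by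
        rw [inv_pow, one_div, inv_pow]
        field_simp
      rw [← h5]
      exact mul_le_mul_of_nonneg_right h3 (by positivity)
    calc N ≤ C ^ L * (2 ^ (1 + K * L) * z ^ D) := h4
      _ ≤ C ^ (L + 1) * (2 ^ ((K + 1) * (L + 1)) * (4 ^ ((K + 2) * M * (L + 1))) ^ D) := by
          have h6 : 1 + K * L ≤ (K + 1) * (L + 1) := by ring_nf; omega
          gcongr
          · omega
          · norm_num
      _ = _ := by
          have h7 : (K + 2) * M * (L + 1) * D = (K + 2) * M * D * (L + 1) := by ring
          rw [mul_pow, mul_pow, ← pow_mul, ← pow_mul, ← pow_mul, h7,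
            mul_assoc (C ^ (L + 1))]
-- Running the exploration inside a graph
section
variable {A : Type*}

theorem injOn_sym2_map {s : Finset ℕ} {g : ℕ → A} (hg : Set.InjOn g s) :
    Set.InjOn (Sym2.map g) (s.sym2 : Set (Sym2 ℕ)) := by
  intro e he e' he' h
  induction e using Sym2.ind with
  | _ a b =>
    induction e' using Sym2.ind with
    | _ c d =>
      simp only [Finset.mem_coe, Finset.mk_mem_sym2_iff] at he he'
      simp only [Sym2.map_mk, Sym2.eq_iff] at h ⊢
      rcases h with ⟨h1, h2⟩ | ⟨h1, h2⟩
      · exact Or.inl ⟨hg he.1 he'.1 h1, hg he.2 he'.2 h2⟩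
      · exact Or.inr ⟨hg he.1 he'.2 h1, hg he.2 he'.1 h2⟩

variable [DecidableEq A]

open scoped Classical in
/-- The preimages in `s` of the edges in `E` under `g`. -/
noncomputable def pullEdges (g : ℕ → A) (s : Finset ℕ) (E : Finset (Sym2 A)) : Finset (Sym2 ℕ) :=
  s.sym2.filter fun e => e.map g ∈ E

theorem mem_pullEdges {g : ℕ → A} {s : Finset ℕ} {E : Finset (Sym2 A)} {e : Sym2 ℕ} :
    e ∈ pullEdges g s E ↔ (∀ i ∈ e, i ∈ s) ∧ e.map g ∈ E := by
  simp [pullEdges, Finset.mem_sym2_iff]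

theorem card_pullEdges {g : ℕ → A} {s : Finset ℕ} (hg : Set.InjOn g s) {E : Finset (Sym2 A)}
    (hE : ∀ e ∈ E, ∀ x ∈ e, x ∈ s.image g) : (pullEdges g s E).card = E.card := by
  rw [← Finset.card_image_of_injOn (s := pullEdges g s E) (f := Sym2.map g)]
  · congr 1
    ext e
    rw [Finset.mem_image]
    constructor
    · rintro ⟨e, he, rfl⟩
      exact (mem_pullEdges.1 he).2
    · intro he
      have := hE e he
      induction e using Sym2.ind with
      | _ x y =>
        obtain ⟨i, hi, rfl⟩ := Finset.mem_image.1 (this x (by simp))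
        obtain ⟨j, hj, rfl⟩ := Finset.mem_image.1 (this y (by simp))
        refine ⟨s(i, j), mem_pullEdges.2 ⟨?_, by simpa using he⟩, by simp⟩
        simp [hi, hj]
  · refine (injOn_sym2_map hg).mono fun e he => ?_
    rw [Finset.mem_coe, mem_pullEdges] at he
    rw [Finset.mem_coe, Finset.mem_sym2_iff]
    exact he.1

theorem exists_extension {g : ℕ → A} {v : ℕ} (hg : Set.InjOn g (Finset.range v)) (B : Finset A) :
    ∃ g' : ℕ → A, (∀ i < v, g' i = g i) ∧
      Set.InjOn g' (Finset.range (v + (B \ (Finset.range v).image g).card)) ∧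
      (Finset.range (v + (B \ (Finset.range v).image g).card)).image g' =
        (Finset.range v).image g ∪ B := by
  set S := (Finset.range v).image g with hS
  set k := (B \ S).card with hk
  set e := (B \ S).equivFin.symm
  have hgS : ∀ i < v, g i ∈ S := fun i hi => Finset.mem_image_of_mem g (Finset.mem_range.2 hi)
  have he : ∀ x, (e x : A) ∈ B ∧ (e x : A) ∉ S := fun x => Finset.mem_sdiff.1 (e x).2
  refine ⟨fun i => if i < v then g i else if h : i - v < k then e ⟨i - v, h⟩ else g i,
    fun i hi => by simp [hi], ?_, ?_⟩
  · intro i hi j hj hij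
    simp only [Finset.coe_range, Set.mem_Iio] at hi hj
    simp only at hij
    by_cases h1 : i < v <;> by_cases h2 : j < v
    · simp only [h1, h2, if_true] at hij
      exact hg (by simpa using h1) (by simpa using h2) hij
    · simp only [h1, h2, if_true, if_false, dif_pos (show j - v < k by omega)] at hij
      exact absurd (hij ▸ hgS i h1) (he _).2
    · simp only [h1, h2, if_true, if_false, dif_pos (show i - v < k by omega)] at hij
      exact absurd (hij ▸ hgS j h2) (he _).2
    · simp only [h1, h2, if_false, dif_pos (show j - v < k by omega),
        dif_pos (show i - v < k by omega)] at hij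
      have := e.injective (Subtype.ext hij)
      simp only [Fin.mk.injEq] at this
      omega
  · ext x
    simp only [Finset.mem_image, Finset.mem_range, Finset.mem_union]
    constructor
    · rintro ⟨i, hi, rfl⟩
      by_cases h1 : i < v
      · simp only [h1, if_true]
        exact Or.inl (hgS i h1)
      · simp only [h1, if_false, dif_pos (show i - v < k by omega)]
        exact Or.inr (he _).1
    · intro hx
      by_cases hxS : x ∈ S
      · obtain ⟨i, hi, rfl⟩ := Finset.mem_image.1 hxS
        rw [Finset.mem_range] at hi
        exact ⟨i, by omega, by simp [hi]⟩
      · have hxB : x ∈ B \ S := Finset.mem_sdiff.2 ⟨hx.resolve_left hxS, hxS⟩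
        have h1 := (e.symm ⟨x, hxB⟩).2
        refine ⟨v + (e.symm ⟨x, hxB⟩ : ℕ), by omega, ?_⟩
        rw [if_neg (by omega), dif_pos (by simp only [Nat.add_sub_cancel_left]; exact h1)]
        simp

variable [Finite A] {G : SimpleGraph A} {m δ : ℝ} {K M : ℕ} {V : Finset A}

/-- The sketch `σ` is realised in `G` by the vertices `g 0, g 1, …`. -/
structure Sketch.IsRealizedBy (σ : Sketch) (G : SimpleGraph A) (g : ℕ → A) : Prop where
  injOn : Set.InjOn g (Finset.range σ.size)
  mem_range : ∀ e ∈ σ.edges, ∀ i ∈ e, i ∈ Finset.range σ.size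
  mem_edgeSet : ∀ e ∈ σ.edges, e.map g ∈ G.edgeSet

/-- The set of vertices found so far. -/
def Sketch.support (σ : Sketch) (g : ℕ → A) : Finset A := (Finset.range σ.size).image g

/-- A tree step is possible at the vertex `v` when the vertices in `S` have been found. -/
def HasTreeStep (G : SimpleGraph A) (m : ℝ) (K : ℕ) (V S : Finset A) (v : A) : Prop :=
  ∃ B : Finset A, B ⊆ V ∧ B.card ≤ K ∧ ¬ B ⊆ S ∧ B ∩ S = {v} ∧
    m * (B \ S).card ≤ (edgesIn G B).card

/-- `B` meets the smaller set still in `v` alone and has the same new vertices. Thus an exhausted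
vertex stays exhausted as the exploration grows. -/
theorem HasTreeStep.anti {S S' : Finset A} {v : A} (h : HasTreeStep G m K V S' v) (hS : S ⊆ S')
    (hv : v ∈ S) : HasTreeStep G m K V S v := by
  obtain ⟨B, h1, h2, h3, h4, h5⟩ := h
  have h6 : B ∩ S = {v} := by
    refine subset_antisymm ((Finset.inter_subset_inter_left hS).trans h4.subset) ?_
    rw [Finset.singleton_subset_iff, Finset.mem_inter]
    refine ⟨?_, hv⟩
    have : v ∈ B ∩ S' := by rw [h4]; simp
    exact (Finset.mem_inter.1 this).1
  refine ⟨B, h1, h2, fun h => h3 (h.trans hS), h6, ?_⟩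
  have h7 : B \ S = B \ S' := by rw [← Finset.sdiff_inter_self_left, h6, ← h4,
    Finset.sdiff_inter_self_left]
  rwa [h7]

/-- The state of an exploration of `V`. -/
structure IsExploring (G : SimpleGraph A) (m δ : ℝ) (K M : ℕ) (V : Finset A) (L : ℕ) (σ : Sketch)
    (g : ℕ → A) : Prop where
  mem : σ ∈ sketches K M L
  pos : 1 ≤ σ.size
  real : σ.IsRealizedBy G g
  subset : σ.support g ⊆ V
  le_card : m * (σ.size - 1) + δ * σ.dense ≤ σ.edges.card
  steps_le : L ≤ σ.edges.card
  exhausted : ∀ i < σ.ptr, ¬ HasTreeStep G m K V (σ.support g) (g i)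

theorem IsExploring.card_support {L : ℕ} {σ : Sketch} {g : ℕ → A}
    (h : IsExploring G m δ K M V L σ g) : (σ.support g).card = σ.size := by
  rw [Sketch.support, Finset.card_image_of_injOn h.real.injOn, Finset.card_range]

/-- The new vertices of `B` receive the next free labels, and `P` is the pullback of all edges
inside `B`. Recorded edges lie inside the old support, so every edge of `B` outside it is new. -/
theorem Sketch.IsRealizedBy.exists_add {σ : Sketch} {g : ℕ → A} (h : σ.IsRealizedBy G g)
    (B : Finset A) :
    ∃ (g' : ℕ → A) (P : Finset (Sym2 ℕ)), (∀ i < σ.size, g' i = g i) ∧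
      P ⊆ (Finset.range (σ.size + (B \ σ.support g).card)).sym2 ∧
      (∀ e ∈ P, ∀ i ∈ e, g' i ∈ B) ∧ P.card = (edgesIn G B).card ∧
      σ.edges.card + (edgesIn G B \ edgesIn G (σ.support g)).card ≤ (σ.edges ∪ P).card ∧
      ∀ t d, (⟨σ.size + (B \ σ.support g).card, σ.edges ∪ P, t, d⟩ : Sketch).IsRealizedBy G g' ∧
        (⟨σ.size + (B \ σ.support g).card, σ.edges ∪ P, t, d⟩ : Sketch).support g' =
          σ.support g ∪ B := by
  obtain ⟨g', h1, h2, h3⟩ := exists_extension h.injOn B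
  change Set.InjOn g' (Finset.range (σ.size + (B \ σ.support g).card)) at h2
  change (Finset.range (σ.size + (B \ σ.support g).card)).image g' = σ.support g ∪ B at h3
  set S := σ.support g with hS
  set r := Finset.range (σ.size + (B \ S).card) with hr
  have hmap : ∀ e ∈ σ.edges, e.map g' = e.map g := fun e he =>
    Sym2.map_congr fun i hi => h1 i (Finset.mem_range.1 (h.mem_range e he i hi))
  have hBr : ∀ E ⊆ edgesIn G B, ∀ e ∈ E, ∀ x ∈ e, x ∈ r.image g' := fun E hE e he x hx => by
    rw [h3]
    exact Finset.mem_union_right _ ((mem_edgesIn.1 (hE he)).1 x hx)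
  refine ⟨g', pullEdges g' r (edgesIn G B), h1, fun e he => ?_, fun e he i hi => ?_,
    card_pullEdges h2 (hBr _ subset_rfl), ?_, fun t d => ⟨⟨h2, fun e he i hi => ?_,
    fun e he => ?_⟩, h3⟩⟩
  · rw [Finset.mem_sym2_iff]
    exact (mem_pullEdges.1 he).1
  · exact (mem_edgesIn.1 (mem_pullEdges.1 he).2).1 _ (Sym2.mem_map.2 ⟨i, hi, rfl⟩)
  · rw [← card_pullEdges h2 (hBr _ Finset.sdiff_subset), ← Finset.card_union_of_disjoint]
    · refine Finset.card_le_card (Finset.union_subset_union subset_rfl fun e he => ?_)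
      rw [mem_pullEdges] at he ⊢
      exact ⟨he.1, (Finset.mem_sdiff.1 he.2).1⟩
    · rw [Finset.disjoint_left]
      intro e he he'
      refine (Finset.mem_sdiff.1 (mem_pullEdges.1 he').2).2 ?_
      rw [hmap e he, mem_edgesIn]
      refine ⟨fun x hx => ?_, h.mem_edgeSet e he⟩
      obtain ⟨i, hi, rfl⟩ := Sym2.mem_map.1 hx
      exact Finset.mem_image_of_mem g (h.mem_range e he i hi)
  · rcases Finset.mem_union.1 he with he | he
    · have := Finset.mem_range.1 (h.mem_range e he i hi)
      exact Finset.mem_range.2 (by simp only; omega)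
    · exact (mem_pullEdges.1 he).1 i hi
  · rcases Finset.mem_union.1 he with he | he
    · rw [hmap e he]
      exact h.mem_edgeSet e he
    · exact (mem_edgesIn.1 (mem_pullEdges.1 he).2).2

theorem not_hasTreeStep_of_support_subset {σ : Sketch} {g g' : ℕ → A} {S' : Finset A} (hg : ∀ i < σ.size, g' i = g i)
    (hS' : σ.support g ⊆ S') {i : ℕ} (hi : i < σ.size)
    (hno : ¬ HasTreeStep G m K V (σ.support g) (g i)) : ¬ HasTreeStep G m K V S' (g' i) := by
  rw [hg i hi]
  exact fun h0 => hno (h0.anti hS' (Finset.mem_image_of_mem g (Finset.mem_range.2 hi)))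

/-- Choosing the smallest possible `t` keeps everything below the new pointer exhausted. -/
theorem IsExploring.exists_tree (hm : 0 < m) {L : ℕ} {σ : Sketch} {g : ℕ → A}
    (h : IsExploring G m δ K M V L σ g) {t : ℕ} (ht : t < σ.size)
    (htree : HasTreeStep G m K V (σ.support g) (g t))
    (hmin : ∀ i < t, ¬ HasTreeStep G m K V (σ.support g) (g i)) :
    ∃ τ g', IsExploring G m δ K M V (L + 1) τ g' ∧ τ.dense = σ.dense := by
  obtain ⟨B, hBV, hBK, hBS, hBt, hBm⟩ := htree
  obtain ⟨g', P, h1, h2, h3, h4, h5, h6⟩ := h.real.exists_add B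
  set S := σ.support g with hS
  have hptr : σ.ptr ≤ t := by
    by_contra! hlt
    exact h.exhausted t hlt ⟨B, hBV, hBK, hBS, hBt, hBm⟩
  have h7 := card_edgesIn_sdiff (G := G) B S
  rw [edgesIn_eq_empty_of_card_le_one (S := B ∩ S) (by simp [hBt]), Finset.card_empty,
    Nat.cast_zero, add_zero] at h7
  have h8 : (1 : ℝ) ≤ (B \ S).card := by
    rw [Nat.one_le_cast, Nat.one_le_iff_ne_zero, Finset.card_ne_zero]
    exact Finset.sdiff_nonempty.2 hBS
  have h9 : (σ.edges.card : ℝ) + (edgesIn G B \ edgesIn G S).card ≤ (σ.edges ∪ P).card := by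
    exact_mod_cast h5
  refine ⟨⟨σ.size + (B \ S).card, σ.edges ∪ P, t, σ.dense⟩, g',
    ⟨mem_sketches_succ.2 ⟨σ, h.mem, Or.inl (mem_treeSteps.2
      ⟨t, (B \ S).card, P, hptr, ht, (Finset.card_le_card Finset.sdiff_subset).trans hBK, ?_,
        rfl⟩)⟩, Nat.le_add_right_of_le h.pos, (h6 _ _).1, ?_, ?_, ?_, ?_⟩, rfl⟩
  · intro e he
    rw [Finset.mem_sym2_iff]
    intro i hi
    have h10 := Finset.mem_sym2_iff.1 (h2 he) i hi
    rw [Finset.mem_range] at h10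
    rw [Finset.mem_insert, Finset.mem_Ico]
    by_cases h11 : i < σ.size
    · left
      have h12 : g i ∈ B ∩ S := Finset.mem_inter.2
        ⟨h1 i h11 ▸ h3 e he i hi, Finset.mem_image_of_mem g (Finset.mem_range.2 h11)⟩
      rw [hBt, Finset.mem_singleton] at h12
      exact h.real.injOn (by simpa using h11) (by simpa using ht) h12
    · right; omega
  · rw [(h6 _ _).2]
    exact Finset.union_subset h.subset hBV
  · have := h.le_card
    push_cast
    linarith
  · have h13 : (0 : ℝ) < (edgesIn G B \ edgesIn G S).card := by nlinarith
    have h14 : 0 < (edgesIn G B \ edgesIn G S).card := by exact_mod_cast h13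
    have := h.steps_le
    simp only
    omega
  · intro i hi
    rw [(h6 _ _).2]
    exact not_hasTreeStep_of_support_subset h1 Finset.subset_union_left (hi.trans ht) (hmin i hi)

theorem IsExploring.exists_dense (hm : 0 < m) (hδ : 0 < δ) {L : ℕ} {σ : Sketch} {g : ℕ → A}
    (h : IsExploring G m δ K M V L σ g) {B : Finset A} (hBV : B ⊆ V) (hBK : B.card ≤ K)
    (hM : (K + 1).choose 2 ≤ M)
    (hB : m * (B \ σ.support g).card + δ ≤
      (edgesIn G B \ edgesIn G (σ.support g)).card) :
    ∃ τ g', IsExploring G m δ K M V (L + 1) τ g' ∧ τ.dense = σ.dense + 1 := by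
  obtain ⟨g', P, h1, h2, h3, h4, h5, h6⟩ := h.real.exists_add B
  set S := σ.support g with hS
  have h9 : (σ.edges.card : ℝ) + (edgesIn G B \ edgesIn G S).card ≤ (σ.edges ∪ P).card := by
    exact_mod_cast h5
  refine ⟨⟨σ.size + (B \ S).card, σ.edges ∪ P, σ.ptr, σ.dense + 1⟩, g',
    ⟨mem_sketches_succ.2 ⟨σ, h.mem, Or.inr (mem_denseSteps.2
      ⟨(B \ S).card, P, (Finset.card_le_card Finset.sdiff_subset).trans hBK, ?_, h2,
        rfl⟩)⟩, Nat.le_add_right_of_le h.pos, (h6 _ _).1, ?_, ?_, ?_, ?_⟩, rfl⟩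
  · rw [h4]
    refine le_trans ?_ hM
    have : edgesIn G B ⊆ B.sym2 := fun e he => Finset.mem_sym2_iff.2 (mem_edgesIn.1 he).1
    refine (Finset.card_le_card this).trans ?_
    rw [Finset.card_sym2]
    exact Nat.choose_le_choose 2 (by omega)
  · rw [(h6 _ _).2]
    exact Finset.union_subset h.subset hBV
  · have := h.le_card
    push_cast
    linarith
  · have h13 : (0 : ℝ) < (edgesIn G B \ edgesIn G S).card := by
      have : 0 ≤ m * (B \ S).card := by positivity
      linarith
    have h14 : 0 < (edgesIn G B \ edgesIn G S).card := by exact_mod_cast h13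
    have := h.steps_le
    simp only
    omega
  · intro i hi
    rw [(h6 _ _).2]
    exact not_hasTreeStep_of_support_subset h1 Finset.subset_union_left
      (hi.trans_le (size_le_of_mem_sketches h.mem).2) (h.exhausted i hi)

/-- Steps record only edges inside the added sets, so edges may be unseen when all of `V` is found.
One such edge is a dense step without new vertices, gaining `1 ≥ δ`. -/
theorem IsExploring.exists_edge (hδ1 : δ ≤ 1) {L : ℕ} {σ : Sketch} {g : ℕ → A}
    (h : IsExploring G m δ K M V L σ g) (hM : 1 ≤ M) (hV : σ.support g = V)
    (hlt : σ.edges.card < (edgesIn G V).card) :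
    ∃ τ g', IsExploring G m δ K M V (L + 1) τ g' ∧ τ.dense = σ.dense + 1 := by
  have h1 : ¬ pullEdges g (Finset.range σ.size) (edgesIn G V) ⊆ σ.edges := by
    intro h0
    have h2 := Finset.card_le_card h0
    rw [card_pullEdges h.real.injOn] at h2
    · omega
    · intro e he x hx
      have := (mem_edgesIn.1 he).1 x hx
      rw [← hV] at this
      exact this
  obtain ⟨e, he, heσ⟩ := Finset.not_subset.1 h1
  rw [mem_pullEdges, mem_edgesIn] at he
  have hcard : (σ.edges ∪ {e}).card = σ.edges.card + 1 := by
    rw [Finset.card_union_of_disjoint (by simpa using heσ), Finset.card_singleton]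
  refine ⟨⟨σ.size + 0, σ.edges ∪ {e}, σ.ptr, σ.dense + 1⟩, g,
    ⟨mem_sketches_succ.2 ⟨σ, h.mem, Or.inr (mem_denseSteps.2 ⟨0, {e}, Nat.zero_le _, by simpa,
      ?_, rfl⟩)⟩, h.pos, ⟨h.real.injOn, fun e' he' => ?_, fun e' he' => ?_⟩, h.subset, ?_, ?_,
      h.exhausted⟩, rfl⟩
  · rw [Finset.singleton_subset_iff, Finset.mem_sym2_iff]
    exact he.1
  · rcases Finset.mem_union.1 he' with he' | he'
    · exact h.real.mem_range e' he'
    · rw [Finset.mem_singleton.1 he']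
      exact he.1
  · rcases Finset.mem_union.1 he' with he' | he'
    · exact h.real.mem_edgeSet e' he'
    · rw [Finset.mem_singleton.1 he']
      exact he.2.2
  · have := h.le_card
    simp only [hcard]
    push_cast
    linarith
  · have := h.steps_le
    simp only [hcard]
    omega

/-- A gap by which the density of dense steps exceeds `m`. -/
theorem exists_density_gap (m : ℝ) (K M : ℕ) : ∃ δ : ℝ, 0 < δ ∧ δ ≤ 1 ∧
    ∀ a ≤ K, ∀ b ≤ M, m * a < b → m * a + δ ≤ b := by
  classical
  set s : Finset ℝ := insert 1 (((Finset.range (K + 1) ×ˢ Finset.range (M + 1)).image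
    fun q : ℕ × ℕ => (q.2 - m * q.1 : ℝ)).filter (0 < ·)) with hs
  obtain ⟨δ, hδ, hmin⟩ := s.exists_min_image id ⟨1, by simp [hs]⟩
  refine ⟨δ, ?_, hmin 1 (by simp [hs]), fun a ha b hb hab => ?_⟩
  · rw [hs, Finset.mem_insert, Finset.mem_filter] at hδ
    rcases hδ with rfl | hδ
    · norm_num
    · exact hδ.2
  · have : (b - m * a : ℝ) ∈ s := by
      rw [hs, Finset.mem_insert, Finset.mem_filter, Finset.mem_image]
      refine Or.inr ⟨⟨(a, b), ?_, rfl⟩, by linarith⟩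
      simp only [Finset.mem_product, Finset.mem_range]
      omega
    have := hmin _ this
    simp only [id] at this
    linarith

/-- An exploration that has not seen enough edges can be continued. -/
theorem IsExploring.exists_next (hm : 0 < m) (hδ : 0 < δ) (hδ1 : δ ≤ 1)
    (hgap : ∀ a ≤ K, ∀ b ≤ M, m * a < b → m * a + δ ≤ b) (hM : (K + 1).choose 2 ≤ M)
    (hM1 : 1 ≤ M) (hV : Explorable G m K V) {L : ℕ} {σ : Sketch} {g : ℕ → A}
    (h : IsExploring G m δ K M V L σ g) (hlt : (σ.edges.card : ℝ) < m * σ.size) :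
    ∃ τ g', IsExploring G m δ K M V (L + 1) τ g' ∧ τ.dense ≤ σ.dense + 1 := by
  classical
  by_cases hSV : σ.support g = V
  · obtain ⟨τ, g', h1, h2⟩ := h.exists_edge hδ1 hM1 hSV (by
      have := hV.2.1
      rw [← h.card_support, hSV] at hlt
      exact_mod_cast hlt.trans_le this)
    exact ⟨τ, g', h1, h2.le⟩
  by_cases htree : ∃ t, t < σ.size ∧ HasTreeStep G m K V (σ.support g) (g t)
  · obtain ⟨τ, g', h1, h2⟩ := h.exists_tree hm (Nat.find_spec htree).1 (Nat.find_spec htree).2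
      fun i hi h0 => Nat.find_min htree hi ⟨hi.trans (Nat.find_spec htree).1, h0⟩
    exact ⟨τ, g', h1, by omega⟩
  · have hne : (σ.support g).Nonempty := by
      rw [← Finset.card_pos, h.card_support]
      exact h.pos
    obtain ⟨B, hBV, hBK, hBS, hB⟩ := hV.2.2 _ hne (h.subset.ssubset_of_ne hSV)
    have hB2 : m * (B \ σ.support g).card + (edgesIn G (B ∩ σ.support g)).card <
        (edgesIn G B).card := by
      -- A one-vertex gluing would be a tree step, and none is left.
      refine hB.resolve_left fun hB1 => htree ?_
      obtain ⟨v, hv⟩ := Finset.card_eq_one.1 hB1.1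
      have hvS : v ∈ σ.support g := by
        have : v ∈ B ∩ σ.support g := by rw [hv]; simp
        exact (Finset.mem_inter.1 this).2
      obtain ⟨t, ht, rfl⟩ := Finset.mem_image.1 hvS
      exact ⟨t, Finset.mem_range.1 ht, B, hBV, hBK, hBS, hv, hB1.2⟩
    have h1 := card_edgesIn_sdiff (G := G) B (σ.support g)
    have h2 : (edgesIn G B \ edgesIn G (σ.support g)).card ≤ M := by
      refine le_trans ?_ hM
      have : edgesIn G B ⊆ B.sym2 := fun e he => Finset.mem_sym2_iff.2 (mem_edgesIn.1 he).1
      refine (Finset.card_le_card (Finset.sdiff_subset.trans this)).trans ?_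
      rw [Finset.card_sym2]
      exact Nat.choose_le_choose 2 (by omega)
    obtain ⟨τ, g', h3, h4⟩ := h.exists_dense hm hδ hBV hBK hM
      (hgap _ ((Finset.card_le_card Finset.sdiff_subset).trans hBK) _ h2 (by linarith))
    exact ⟨τ, g', h3, h4.le⟩

/-- A graph with an explorable set contains a dense sketch with few dense steps. -/
theorem Explorable.exists_sketch (hm : 0 < m) (hδ : 0 < δ) (hδ1 : δ ≤ 1)
    (hgap : ∀ a ≤ K, ∀ b ≤ M, m * a < b → m * a + δ ≤ b) (hM : (K + 1).choose 2 ≤ M)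
    (hM1 : 1 ≤ M) (hV : Explorable G m K V) :
    ∃ L, ∃ σ ∈ sketches K M L, σ.dense ≤ ⌈m / δ⌉₊ + 1 ∧ m * σ.size ≤ σ.edges.card ∧
      L ≤ σ.edges.card ∧ 1 ≤ σ.size ∧ ∃ g, σ.IsRealizedBy G g := by
  by_contra! hno
  have key : ∀ L, ∃ σ g, IsExploring G m δ K M V L σ g ∧ σ.dense ≤ ⌈m / δ⌉₊ + 1 := by
    intro L
    induction L with
    | zero =>
      obtain ⟨v, hv⟩ := hV.1
      refine ⟨⟨1, ∅, 0, 0⟩, fun _ => v, ⟨by simp [sketches], le_rfl,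
        ⟨by simp, by simp, by simp⟩, by simp [Sketch.support, hv], by simp, by simp, by simp⟩,
        by simp⟩
    | succ L ih =>
      obtain ⟨σ, g, h1, h2⟩ := ih
      have hlt : (σ.edges.card : ℝ) < m * σ.size := by
        by_contra! hle
        exact hno L σ h1.mem h2 hle h1.steps_le h1.pos g h1.real
      obtain ⟨τ, g', h3, h4⟩ := h1.exists_next hm hδ hδ1 hgap hM hM1 hV hlt
      refine ⟨τ, g', h3, h4.trans (Nat.add_le_add_right ?_ 1)⟩
      -- As fewer than m · size edges are seen, δ · dense is less than `m`; the next step adds at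
      -- most one dense step.
      have h5 := h1.le_card
      have h6 : (σ.dense : ℝ) ≤ m / δ := by
        rw [le_div_iff₀ hδ]
        linarith
      exact_mod_cast h6.trans (Nat.le_ceil _)
  -- Every step records a new edge, so after this many steps there are at least m|V| ≥ m · size of
  -- them.
  obtain ⟨σ, g, h1, h2⟩ := key ⌈m * V.card⌉₊
  refine hno _ σ h1.mem h2 ?_ h1.steps_le h1.pos g h1.real
  have h3 : (σ.size : ℝ) ≤ V.card := by
    rw [← h1.card_support]
    exact_mod_cast Finset.card_le_card h1.subset
  have h4 : (⌈m * V.card⌉₊ : ℝ) ≤ σ.edges.card := by exact_mod_cast h1.steps_le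
  exact ((mul_le_mul_of_nonneg_left h3 hm.le).trans (Nat.le_ceil _)).trans h4
end
-- First moment estimate
open MeasureTheory ENNReal

theorem binomialRandom_edges_le {V : Type*} [Countable V] (p : unitInterval)
    (E : Finset (Sym2 V)) :
    SimpleGraph.binomialRandom V p {G | ∀ e ∈ E, e ∈ G.edgeSet} ≤
      ENNReal.ofReal p ^ E.card := by
  rw [SimpleGraph.binomialRandom_apply]
  refine (measure_mono (t := Set.pi E fun _ => {True}) ?_).trans ?_
  · rintro _ ⟨G, hG, rfl⟩ e he
    simpa using hG e he
  · rw [Measure.infinitePi_pi _ (fun _ _ => MeasurableSet.of_discrete), ← Finset.prod_const]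
    refine Finset.prod_le_prod' fun e _ => ?_
    have h : ENNReal.ofReal (p : ℝ) = (unitInterval.toNNReal p : ℝ≥0∞) := by
      rw [← unitInterval.coe_toNNReal, ENNReal.ofReal_coe_nnreal]
    rw [h]
    by_cases he : e.IsDiag
    · simp [he]
    · simp [he]

theorem binomialRandom_isRealizedBy_le {A : Type*} [Fintype A] [DecidableEq A] [Nonempty A]
    (p : unitInterval) (σ : Sketch) :
    SimpleGraph.binomialRandom A p {G | ∃ g, σ.IsRealizedBy G g} ≤
      (Fintype.card A : ℝ≥0∞) ^ σ.size * ENNReal.ofReal p ^ σ.edges.card := by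
  classical
  by_cases hσ : ∀ e ∈ σ.edges, ∀ i ∈ e, i ∈ Finset.range σ.size
  -- Only the values of `g` below `σ.size` matter, so the union bound runs over finitely many
  -- placements; beyond them the value is arbitrary.
  · let x : (Fin σ.size → A) → ℕ → A := fun h i =>
      if hi : i < σ.size then h ⟨i, hi⟩ else Classical.arbitrary A
    have hx : ∀ g : ℕ → A, ∀ i < σ.size, x (fun j => g j) i = g i := fun g i hi => by
      simp [x, hi]
    set I := Finset.univ.filter fun h : Fin σ.size → A => Set.InjOn (x h) (Finset.range σ.size)
    have hsub : {G | ∃ g, σ.IsRealizedBy G g} ⊆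
        ⋃ h ∈ I, {G : SimpleGraph A | ∀ e ∈ σ.edges.image (Sym2.map (x h)), e ∈ G.edgeSet} := by
      rintro G ⟨g, hg⟩
      simp only [Set.mem_iUnion]
      refine ⟨fun j => g j, ?_, ?_⟩
      · rw [Finset.mem_filter]
        refine ⟨Finset.mem_univ _, hg.injOn.congr fun i hi => (hx g i ?_).symm⟩
        simpa using hi
      · intro e he
        obtain ⟨e', he', rfl⟩ := Finset.mem_image.1 he
        rw [Sym2.map_congr (g := g) fun i hi => hx g i (Finset.mem_range.1 (hσ e' he' i hi))]
        exact hg.mem_edgeSet e' he'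
    refine (measure_mono hsub).trans ((measure_biUnion_finset_le _ _).trans ?_)
    refine (Finset.sum_le_card_nsmul _ _ (ENNReal.ofReal p ^ σ.edges.card) fun h hh => ?_).trans ?_
    · refine (binomialRandom_edges_le p _).trans (le_of_eq ?_)
      rw [Finset.card_image_of_injOn]
      refine (injOn_sym2_map (Finset.mem_filter.1 hh).2).mono fun e he => ?_
      rw [Finset.mem_coe, Finset.mem_sym2_iff]
      exact hσ e he
    · rw [nsmul_eq_mul]
      gcongr
      calc (I.card : ℝ≥0∞) ≤ (Fintype.card (Fin σ.size → A) : ℕ) := by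
            exact_mod_cast Finset.card_le_univ I
        _ = _ := by simp
  · have : {G : SimpleGraph A | ∃ g, σ.IsRealizedBy G g} = ∅ := by
      ext G
      simp only [Set.mem_ofPred_eq, Set.mem_empty_iff_false, iff_false]
      rintro ⟨g, hg⟩
      exact hσ hg.mem_range
    rw [this]
    simp

theorem pow_mul_pow_le {n v e : ℕ} (hn : 1 ≤ n) {m p c : ℝ} (hm : 0 < m) (hp : 0 ≤ p)
    (hc : 0 ≤ c) (hpc : p ≤ c * (n : ℝ) ^ (-1 / m)) (he : m * v ≤ e) :
    (n : ℝ) ^ v * p ^ e ≤ c ^ e := by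
  have hn' : (1 : ℝ) ≤ n := by exact_mod_cast hn
  have h1 : (n : ℝ) ^ v * ((n : ℝ) ^ (-1 / m)) ^ e ≤ 1 := by
    rw [← Real.rpow_natCast, ← Real.rpow_natCast, ← Real.rpow_mul (by positivity),
      ← Real.rpow_add (by positivity)]
    refine Real.rpow_le_one_of_one_le_of_nonpos hn' ?_
    have : (v : ℝ) ≤ e / m := by rw [le_div_iff₀ hm]; linarith
    have h2 : -1 / m * e = -(e / m) := by ring
    linarith
  calc (n : ℝ) ^ v * p ^ e ≤ (n : ℝ) ^ v * (c * (n : ℝ) ^ (-1 / m)) ^ e := by gcongr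
    _ = c ^ e * ((n : ℝ) ^ v * ((n : ℝ) ^ (-1 / m)) ^ e) := by rw [mul_pow]; ring
    _ ≤ c ^ e * 1 := by gcongr
    _ = c ^ e := mul_one _

/-- Explorable sets do not appear below the threshold `n ^ (-1 / m)`. -/
theorem tendsto_explorable {m : ℝ} (hm : 0 < m) (K : ℕ) {p : ℕ → unitInterval}
    (hp : (fun n : ℕ => (p n : ℝ)) =o[atTop] (fun n : ℕ => (n : ℝ) ^ (-1 / m))) :
    Tendsto (fun n : ℕ => SimpleGraph.binomialRandom (Fin n) (p n)
      {G | ∃ V, Explorable G m K V}) atTop (𝓝 0) := by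
  set M := (K + 1).choose 2 + 1
  obtain ⟨δ, hδ, hδ1, hgap⟩ := exists_density_gap m K M
  set D := ⌈m / δ⌉₊ + 1
  obtain ⟨a, ha1, ha⟩ := exists_card_sketches_le K M D
  rw [ENNReal.tendsto_nhds_zero]
  intro η hη
  obtain ⟨r, hr0, hr⟩ : ∃ r : ℝ, 0 < r ∧ r ≤ 1 / 2 ∧ 2 * ENNReal.ofReal r ≤ η := by
    obtain ⟨c, hc0, hc⟩ := ENNReal.lt_iff_exists_nnreal_btwn.1 hη
    have hc0' : (0 : ℝ) < c := by exact_mod_cast hc0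
    refine ⟨min (1 / 2) (c / 2), by positivity, min_le_left _ _, le_trans ?_ hc.le⟩
    calc 2 * ENNReal.ofReal (min (1 / 2) (c / 2)) ≤ ENNReal.ofReal 2 * ENNReal.ofReal (c / 2) := by
          rw [ENNReal.ofReal_ofNat]
          gcongr
          exact min_le_right _ _
      _ = c := by
          rw [← ENNReal.ofReal_mul (by norm_num), mul_div_cancel₀ _ (by norm_num),
            ENNReal.ofReal_coe_nnreal]
  have ha0 : 0 < a := by linarith
  -- With at most `a ^ (L + 1)` sketches, probability `s ^ (L + 1)` for each leaves `r ^ (L + 1)`.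
  set s := r / a with hs
  have hs0 : 0 < s := by positivity
  have hs1 : s ≤ 1 := by rw [hs, div_le_one ha0]; linarith
  filter_upwards [hp.def (show 0 < s ^ 2 by positivity), eventually_ge_atTop 1] with n hn hn1
  have : NeZero n := ⟨by omega⟩
  have hpn : (p n : ℝ) ≤ s ^ 2 * (n : ℝ) ^ (-1 / m) := by
    rwa [Real.norm_of_nonneg (p n).2.1, Real.norm_of_nonneg (by positivity)] at hn
  set F : ℕ → Finset Sketch := fun L => (sketches K M L).filter fun σ => σ.dense ≤ D with hF
  set F' : ℕ → Finset Sketch := fun L =>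
    open scoped Classical in (F L).filter fun σ => m * σ.size ≤ σ.edges.card ∧
      L ≤ σ.edges.card ∧ 1 ≤ σ.size with hF'
  have hsub : {G : SimpleGraph (Fin n) | ∃ V, Explorable G m K V} ⊆
      ⋃ L, ⋃ σ ∈ F' L, {G | ∃ g, σ.IsRealizedBy G g} := by
    rintro G ⟨V, hV⟩
    obtain ⟨L, σ, hσ, h1, h2, h3, h4, h5⟩ :=
      hV.exists_sketch hm hδ hδ1 hgap (Nat.le_succ _) (Nat.succ_pos _)
    simp only [Set.mem_iUnion]
    exact ⟨L, σ, by simp [hF, hF', hσ, h1, h2, h3, h4, D], h5⟩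
  have hterm : ∀ L, ∀ σ ∈ F' L, SimpleGraph.binomialRandom (Fin n) (p n)
      {G | ∃ g, σ.IsRealizedBy G g} ≤ ENNReal.ofReal (s ^ (L + 1)) := by
    intro L σ hσ
    simp only [hF', Finset.mem_filter] at hσ
    obtain ⟨-, h1, h2, h3⟩ := hσ
    have h4 : 0 < σ.edges.card := by
      have h5 : (0 : ℝ) < m * σ.size := by
        have : (1 : ℝ) ≤ σ.size := by exact_mod_cast h3
        positivity
      exact_mod_cast h5.trans_le h1
    refine (binomialRandom_isRealizedBy_le (p n) σ).trans ?_
    rw [Fintype.card_fin, ← ENNReal.ofReal_natCast, ← ENNReal.ofReal_pow (by positivity),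
      ← ENNReal.ofReal_pow (p n).2.1, ← ENNReal.ofReal_mul (by positivity)]
    refine ENNReal.ofReal_le_ofReal ((pow_mul_pow_le hn1 hm (p n).2.1 (by positivity)
      hpn h1).trans ?_)
    -- The square in `s ^ 2` serves here: e ≥ L and e ≥ 1 give 2e ≥ L + 1.
    rw [← pow_mul]
    exact pow_le_pow_of_le_one hs0.le hs1 (by omega)
  calc SimpleGraph.binomialRandom (Fin n) (p n) {G | ∃ V, Explorable G m K V}
      ≤ ∑' L, SimpleGraph.binomialRandom (Fin n) (p n)
          (⋃ σ ∈ F' L, {G | ∃ g, σ.IsRealizedBy G g}) :=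
        (measure_mono hsub).trans (measure_iUnion_le _)
    _ ≤ ∑' L : ℕ, ENNReal.ofReal r ^ (L + 1) := by
        refine ENNReal.tsum_le_tsum fun L => ?_
        refine (measure_biUnion_finset_le _ _).trans ?_
        refine (Finset.sum_le_card_nsmul _ _ _ (hterm L)).trans ?_
        rw [nsmul_eq_mul, ← ENNReal.ofReal_natCast, ← ENNReal.ofReal_mul (by positivity),
          ← ENNReal.ofReal_pow hr0.le]
        refine ENNReal.ofReal_le_ofReal ?_
        have h1 : ((F' L).card : ℝ) ≤ a ^ (L + 1) := by
          refine le_trans ?_ (ha L)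
          exact_mod_cast Finset.card_le_card (Finset.filter_subset _ _)
        calc ((F' L).card : ℝ) * s ^ (L + 1) ≤ a ^ (L + 1) * s ^ (L + 1) := by gcongr
          _ = r ^ (L + 1) := by rw [← mul_pow, hs, mul_div_cancel₀ _ ha0.ne']
    _ ≤ ENNReal.ofReal r * 2 := by
        rw [ENNReal.tsum_geometric_add_one]
        gcongr
        rw [ENNReal.inv_le_iff_inv_le]
        have h2 : ENNReal.ofReal r ≤ 2⁻¹ := by
          rw [← ENNReal.ofReal_ofNat, ← ENNReal.ofReal_inv_of_pos (by norm_num)]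
          exact ENNReal.ofReal_le_ofReal (by linarith [hr.1])
        calc (2⁻¹ : ℝ≥0∞) = 1 - 2⁻¹ := ENNReal.one_sub_inv_two.symm
          _ ≤ 1 - ENNReal.ofReal r := tsub_le_tsub_left h2 1
    _ ≤ η := by rw [mul_comm]; exact hr.2

/-! ### The densities and `β` -/

theorem exists_eq_sSup {ι : Type*} [Finite ι] {P : ι → Prop} {φ : ι → ℝ} (h : ∃ J, P J) :
    ∃ J, P J ∧ sSup {x : ℝ | ∃ J, P J ∧ x = φ J} = φ J := by
  have hfin : {x : ℝ | ∃ J, P J ∧ x = φ J}.Finite := by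
    refine (Set.finite_range φ).subset ?_
    rintro _ ⟨J, -, rfl⟩
    exact ⟨J, rfl⟩
  obtain ⟨J, hJ⟩ := h
  have hne : {x : ℝ | ∃ J, P J ∧ x = φ J}.Nonempty := ⟨φ J, J, hJ, rfl⟩
  exact hne.csSup_mem hfin

theorem le_sSup_of_finite {ι : Type*} [Finite ι] {P : ι → Prop} {φ : ι → ℝ} {J : ι} (h : P J) :
    φ J ≤ sSup {x : ℝ | ∃ J, P J ∧ x = φ J} := by
  refine le_csSup ?_ ⟨J, h, rfl⟩
  refine ((Set.finite_range φ).subset ?_).bddAbove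
  rintro _ ⟨J, -, rfl⟩
  exact ⟨J, rfl⟩

section
variable {V W : Type*} {F : SimpleGraph V} {H : SimpleGraph W}

theorem two_le_card_of_numEdges [Finite V] (h : 1 ≤ numEdges F) : 2 ≤ (⊤ : F.Subgraph).verts.ncard := by
  have hne : F.edgeSet.Nonempty := by
    rw [← Set.ncard_pos]
    exact h
  obtain ⟨e, he⟩ := hne
  induction e using Sym2.ind with
  | _ x y =>
    have hxy : x ≠ y := F.ne_of_adj he
    rw [SimpleGraph.Subgraph.verts_top, ← Set.ncard_pair hxy]
    exact Set.ncard_le_ncard (Set.subset_univ _)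

theorem oneDensity_nonneg (F : SimpleGraph V) : 0 ≤ oneDensity F := by
  refine Real.sSup_nonneg ?_
  rintro _ ⟨J, hJ, rfl⟩
  have : (2 : ℝ) ≤ J.verts.ncard := by exact_mod_cast hJ
  exact div_nonneg (by positivity) (by linarith)

theorem oneDensity_eq_zero [Finite V] (h : numEdges F = 0) : oneDensity F = 0 := by
  refine le_antisymm (Real.sSup_nonpos ?_) (oneDensity_nonneg F)
  rintro _ ⟨J, hJ, rfl⟩
  have h1 : J.edgeSet.ncard = 0 :=
    Nat.le_zero.1 (h ▸ Set.ncard_le_ncard J.edgeSet_subset)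
  simp [h1]

theorem oneDensity_pos [Finite V] (h : 1 ≤ numEdges F) : 0 < oneDensity F := by
  have h2 := two_le_card_of_numEdges h
  refine lt_of_lt_of_le ?_ (le_sSup_of_finite
    (P := fun J : F.Subgraph => 2 ≤ J.verts.ncard)
    (φ := fun J : F.Subgraph => (J.edgeSet.ncard : ℝ) / ((J.verts.ncard : ℝ) - 1)) h2)
  have h3 : (2 : ℝ) ≤ (⊤ : F.Subgraph).verts.ncard := by exact_mod_cast h2
  have h4 : (1 : ℝ) ≤ (⊤ : F.Subgraph).edgeSet.ncard := by
    rw [SimpleGraph.Subgraph.edgeSet_top]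
    exact_mod_cast h
  exact div_pos (by linarith) (by linarith)

theorem exists_oneDensity [Finite V] (h : 1 ≤ numEdges F) : ∃ J : F.Subgraph, 2 ≤ J.verts.ncard ∧
    oneDensity F * (J.verts.ncard - 1) = J.edgeSet.ncard := by
  obtain ⟨J, h1, h2⟩ := exists_eq_sSup
    (P := fun J : F.Subgraph => 2 ≤ J.verts.ncard)
    (φ := fun J : F.Subgraph => (J.edgeSet.ncard : ℝ) / ((J.verts.ncard : ℝ) - 1))
    ⟨⊤, two_le_card_of_numEdges h⟩
  refine ⟨J, h1, ?_⟩
  have h3 : (2 : ℝ) ≤ J.verts.ncard := by exact_mod_cast h1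
  rw [oneDensity, h2]
  exact div_mul_cancel₀ _ (by linarith)

theorem exists_kreuterDensity [Finite W] (F : SimpleGraph V) (h : 1 ≤ numEdges H) :
    ∃ J : H.Subgraph, 2 ≤ J.verts.ncard ∧
    kreuterDensity F H * J.verts.ncard = oneDensity F + J.edgeSet.ncard := by
  obtain ⟨J, h1, h2⟩ := exists_eq_sSup
    (P := fun J : H.Subgraph => 2 ≤ J.verts.ncard)
    (φ := fun J : H.Subgraph => (oneDensity F + (J.edgeSet.ncard : ℝ)) / (J.verts.ncard : ℝ))
    ⟨⊤, two_le_card_of_numEdges h⟩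
  refine ⟨J, h1, ?_⟩
  have h3 : (2 : ℝ) ≤ J.verts.ncard := by exact_mod_cast h1
  rw [kreuterDensity, h2]
  exact div_mul_cancel₀ _ (by linarith)

/-- Test with the subgraph attaining m₁(H): there m₁(F) + e_J ≥ m₁(F) v_J. -/
theorem oneDensity_le_kreuterDensity [Finite W] (h : 1 ≤ numEdges H) (hle : oneDensity F ≤ oneDensity H) :
    oneDensity F ≤ kreuterDensity F H := by
  obtain ⟨J, h1, h2⟩ := exists_oneDensity h
  refine le_trans ?_ (le_sSup_of_finite
    (P := fun J : H.Subgraph => 2 ≤ J.verts.ncard)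
    (φ := fun J : H.Subgraph => (oneDensity F + (J.edgeSet.ncard : ℝ)) / (J.verts.ncard : ℝ)) h1)
  have h3 : (2 : ℝ) ≤ J.verts.ncard := by exact_mod_cast h1
  rw [le_div_iff₀ (by linarith), ← h2]
  nlinarith

theorem exists_maxDensity [Finite V] [Nonempty V] (F : SimpleGraph V) : ∃ J : F.Subgraph,
    0 < J.verts.ncard ∧ maxDensity F * J.verts.ncard = J.edgeSet.ncard := by
  obtain ⟨J, h1, h2⟩ := exists_eq_sSup
    (P := fun J : F.Subgraph => 0 < J.verts.ncard)
    (φ := fun J : F.Subgraph => (J.edgeSet.ncard : ℝ) / (J.verts.ncard : ℝ))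
    ⟨⊤, by rw [SimpleGraph.Subgraph.verts_top, Set.ncard_pos]; exact Set.univ_nonempty⟩
  refine ⟨J, h1, ?_⟩
  have h3 : (0 : ℝ) < J.verts.ncard := by exact_mod_cast h1
  rw [maxDensity, h2]
  exact div_mul_cancel₀ _ h3.ne'

/-- The first case needs an edge of `F`, the second a negative m₁(H), and positivity excludes the
default value 0. -/
theorem beta_eq_maxDensity_right [Finite V] (hF : numEdges F = 0) (h : 0 < beta F H) :
    beta F H = maxDensity H := by
  have h0 := oneDensity_eq_zero hF
  have h1 := oneDensity_nonneg H
  unfold beta at h ⊢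
  split_ifs at h ⊢ with h2 h3 h4 h5
  · omega
  · linarith [h3.1]
  · rfl
  · omega
  · exact absurd h (lt_irrefl _)

theorem beta_eq_maxDensity_left [Finite V] [Finite W] (hH : numEdges H = 0) (h : 0 < beta F H) :
    beta F H = maxDensity F := by
  have h0 := oneDensity_eq_zero hH
  unfold beta at h ⊢
  split_ifs at h ⊢ with h2 h3 h4 h5
  · linarith [oneDensity_pos h2.2, h2.1]
  · omega
  · omega
  · rfl
  · exact absurd h (lt_irrefl _)

theorem beta_eq_kreuterDensity (hF : 1 ≤ numEdges F) (h : oneDensity F ≤ oneDensity H) :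
    beta F H = kreuterDensity F H := by
  rw [beta, if_pos ⟨h, hF⟩]

theorem beta_eq_kreuterDensity_swap (hH : 1 ≤ numEdges H) (h : oneDensity H < oneDensity F) :
    beta F H = kreuterDensity H F := by
  rw [beta, if_neg fun h0 => h0.1.not_gt h, if_pos ⟨h, hH⟩]

/-- This supplies `μ ≤ m` for the critical sets. -/
theorem min_oneDensity_le_beta [Finite V] [Finite W] (hF : 1 ≤ numEdges F) (hH : 1 ≤ numEdges H) {μ : ℝ}
    (h1 : μ ≤ oneDensity F) (h2 : μ ≤ oneDensity H) : μ ≤ beta F H := by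
  rcases le_or_gt (oneDensity F) (oneDensity H) with h | h
  · rw [beta_eq_kreuterDensity hF h]
    exact h1.trans (oneDensity_le_kreuterDensity hH h)
  · rw [beta_eq_kreuterDensity_swap hH h]
    exact h2.trans (oneDensity_le_kreuterDensity hF h.le)

theorem exists_image_of_copy [Finite V] {A : Type*} [Finite A] {G : SimpleGraph A}
    (f : SimpleGraph.Copy F G) (J : F.Subgraph) :
    ∃ T : Finset A, T.card = J.verts.ncard ∧ J.edgeSet.ncard ≤ (edgesIn G T).card ∧
      ∀ x ∈ T, ∃ v, f v = x := by
  have hfin : (f '' J.verts).Finite := Set.toFinite _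
  refine ⟨hfin.toFinset, ?_, ?_, ?_⟩
  · rw [← Set.ncard_eq_toFinset_card _ hfin, Set.ncard_image_of_injective (f := f) _ f.injective]
  · rw [← Set.ncard_image_of_injective J.edgeSet (Sym2.map.injective f.injective),
      ← Set.ncard_coe_finset]
    refine Set.ncard_le_ncard ?_
    rintro _ ⟨e, he, rfl⟩
    rw [Finset.mem_coe, mem_edgesIn]
    induction e using Sym2.ind with
    | _ x y =>
      rw [SimpleGraph.Subgraph.mem_edgeSet] at he
      refine ⟨?_, ?_⟩
      · intro a ha
        rw [Sym2.map_mk, Sym2.mem_iff] at ha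
        rw [Set.Finite.mem_toFinset]
        rcases ha with rfl | rfl
        · exact Set.mem_image_of_mem f he.fst_mem
        · exact Set.mem_image_of_mem f he.snd_mem
      · rw [Sym2.map_mk, SimpleGraph.mem_edgeSet]
        exact f.toHom.map_adj he.adj_sub
  · intro x hx
    rw [Set.Finite.mem_toFinset] at hx
    obtain ⟨v, -, rfl⟩ := hx
    exact ⟨v, rfl⟩
end

/-! ### From failing colourings to explorable sets -/

section
variable {ι κ : Type*} [Finite ι] [Finite κ] {V : ι → Type*} [∀ i, Finite (V i)]
  {W : κ → Type*} [∀ j, Finite (W j)] {F : ∀ i, SimpleGraph (V i)} {H : ∀ j, SimpleGraph (W j)}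

theorem exists_ncard_verts_le (F : ∀ i, SimpleGraph (V i)) :
    ∃ K : ℕ, ∀ i, ∀ J : (F i).Subgraph, J.verts.ncard ≤ K := by
  obtain ⟨K, hK⟩ := (Set.finite_range fun i => Nat.card (V i)).bddAbove
  refine ⟨K, fun i J => le_trans ?_ (hK ⟨i, rfl⟩)⟩
  exact Set.ncard_le_card _

/-- Without an explorable set, some `U` meets all bounded blue critical sets and contains no bounded
red one. Colour `U` with `k₁`: a `k₁`-copy would put a red critical set into `U`, and a `k₂`-copy a
blue one outside it. -/
theorem exists_colouring_or_explorable {μ m : ℝ} (hμ : 0 < μ) (hμm : μ ≤ m)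
    (hF : ∀ i, ∃ J : (F i).Subgraph, 2 ≤ J.verts.ncard ∧
      μ * (J.verts.ncard - 1) ≤ J.edgeSet.ncard)
    (hH : ∀ j, ∃ J : (H j).Subgraph, 2 ≤ J.verts.ncard ∧
      m * J.verts.ncard - μ ≤ J.edgeSet.ncard) {k₁ k₂ : Colour} (hk : k₁ ≠ k₂) :
    ∃ K : ℕ, ∀ (n : ℕ) (G : SimpleGraph (Fin n)),
      (∃ c : Fin n → Colour, (∀ i, ¬ HasCopyOfColour G c k₁ (F i)) ∧
        ∀ j, ¬ HasCopyOfColour G c k₂ (H j)) ∨ ∃ S, Explorable G m K S := by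
  obtain ⟨K₁, hK₁⟩ := exists_ncard_verts_le F
  obtain ⟨K₂, hK₂⟩ := exists_ncard_verts_le H
  set K := max K₁ K₂
  refine ⟨K + K * K, fun n G => ?_⟩
  rw [or_iff_not_imp_right]
  intro hno
  have h := mt (exists_explorable (G := G) (K := K) hμ hμm) hno
  push Not at h
  obtain ⟨U, hU, hUR⟩ := h
  refine ⟨fun v => if v ∈ U then k₁ else k₂, fun i => ?_, fun j => ?_⟩
  · rintro ⟨f, hf⟩
    obtain ⟨J, hJ, hJe⟩ := hF i
    obtain ⟨T, hT, hTe, hTf⟩ := exists_image_of_copy f J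
    have hTe' : (J.edgeSet.ncard : ℝ) ≤ (edgesIn G T).card := by exact_mod_cast hTe
    obtain ⟨R, hRT, hR⟩ := exists_isCritical_subset (G := G) (a := μ) (b := μ) (hT ▸ hJ) (by
      rw [hT]; linarith)
    refine hUR R hR ?_ fun x hx => ?_
    · exact (Finset.card_le_card hRT).trans (hT ▸ (hK₁ i J).trans (le_max_left _ _))
    · obtain ⟨v, rfl⟩ := hTf x (hRT hx)
      by_contra hvU
      have := hf v
      simp only [if_neg hvU] at this
      exact hk this.symm
  · rintro ⟨f, hf⟩
    obtain ⟨J, hJ, hJe⟩ := hH j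
    obtain ⟨T, hT, hTe, hTf⟩ := exists_image_of_copy f J
    have hTe' : (J.edgeSet.ncard : ℝ) ≤ (edgesIn G T).card := by exact_mod_cast hTe
    obtain ⟨B, hBT, hB⟩ := exists_isCritical_subset (G := G) (a := m) (b := μ) (hT ▸ hJ) (by
      rw [hT]; linarith)
    obtain ⟨x, hx⟩ := hU B hB
      ((Finset.card_le_card hBT).trans (hT ▸ (hK₂ j J).trans (le_max_right _ _)))
    rw [Finset.mem_inter] at hx
    obtain ⟨v, rfl⟩ := hTf x (hBT hx.1)
    have := hf v
    simp only [if_pos hx.2] at this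
    exact hk this

/-- A minimal dense subset is explorable in one step: every proper part has density below `m`, so
the whole set gains more than `m` edges per new vertex. -/
theorem exists_explorable_of_dense {A : Type*} [Finite A] [DecidableEq A] {G : SimpleGraph A}
    {m : ℝ} {T : Finset A} (hT : T.Nonempty) (h : m * T.card ≤ (edgesIn G T).card) :
    ∃ S, Explorable G m T.card S := by
  obtain ⟨S, hST, hS⟩ := exists_minimal_le_of_wellFoundedLT
    (fun S : Finset A => S.Nonempty ∧ m * S.card ≤ (edgesIn G S).card) T ⟨hT, h⟩
  refine ⟨S, hS.1.1, hS.1.2, fun S' hS' hlt => ⟨S, subset_rfl, Finset.card_le_card hST, hlt.2,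
    Or.inr ?_⟩⟩
  rw [Finset.inter_eq_right.2 hlt.1]
  have h1 : ((edgesIn G S').card : ℝ) < m * S'.card := by
    by_contra! hle
    exact hlt.2 (hS.2 ⟨hS', hle⟩ hlt.1)
  have h2 := Finset.card_sdiff_add_card_inter S S'
  rw [Finset.inter_eq_right.2 hlt.1] at h2
  have h3 : ((S \ S').card : ℝ) + S'.card = S.card := by exact_mod_cast h2
  have h4 := hS.1.2
  rw [← h3] at h4
  linarith

theorem Explorable.mono {A : Type*} [Finite A] [DecidableEq A] {G : SimpleGraph A}
    {m : ℝ} {K K' : ℕ} {S : Finset A} (h : Explorable G m K S) (hK : K ≤ K') :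
    Explorable G m K' S :=
  ⟨h.1, h.2.1, fun S' h1 h2 => by
    obtain ⟨B, h3, h4, h5⟩ := h.2.2 S' h1 h2
    exact ⟨B, h3, h4.trans hK, h5⟩⟩

theorem exists_copy_free_or_explorable {m : ℝ}
    (hH : ∀ j, ∃ J : (H j).Subgraph, 0 < J.verts.ncard ∧ m * J.verts.ncard ≤ J.edgeSet.ncard) :
    ∃ K : ℕ, ∀ (n : ℕ) (G : SimpleGraph (Fin n)),
      (∀ j, IsEmpty (SimpleGraph.Copy (H j) G)) ∨ ∃ S, Explorable G m K S := by
  obtain ⟨K, hK⟩ := exists_ncard_verts_le H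
  refine ⟨K, fun n G => ?_⟩
  rw [or_iff_not_imp_right]
  refine fun hno j => ⟨fun f => hno ?_⟩
  obtain ⟨J, hJ, hJe⟩ := hH j
  obtain ⟨T, hT, hTe, -⟩ := exists_image_of_copy f J
  have hTe' : (J.edgeSet.ncard : ℝ) ≤ (edgesIn G T).card := by exact_mod_cast hTe
  obtain ⟨S, hS⟩ := exists_explorable_of_dense (G := G) (m := m) (T := T)
    (Finset.card_pos.1 (hT ▸ hJ)) (by rw [hT]; linarith)
  exact ⟨S, hS.mono (hT ▸ hK j J)⟩

/-- Below all the exponents `β`, a graph without explorable set has a good colouring. -/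
theorem exists_forall_colouring_or_explorable [∀ i, Nonempty (V i)] [∀ j, Nonempty (W j)]
    {m : ℝ} (hm : IsLeast {x : ℝ | ∃ (i : ι) (j : κ), x = beta (F i) (H j)} m)
    (hm_pos : 0 < m) :
    ∃ K : ℕ, ∀ (n : ℕ) (G : SimpleGraph (Fin n)),
      (∃ c : Fin n → Colour, (∀ i, ¬ HasCopyOfColour G c Colour.red (F i)) ∧
        ∀ j, ¬ HasCopyOfColour G c Colour.blue (H j)) ∨ ∃ S, Explorable G m K S := by
  have hle : ∀ i j, m ≤ beta (F i) (H j) := fun i j => hm.2 ⟨i, j, rfl⟩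
  obtain ⟨i₀, j₀, hm₀⟩ := hm.1
  by_cases hF0 : ∃ i, numEdges (F i) = 0
  · obtain ⟨i, hi⟩ := hF0
    obtain ⟨K, hK⟩ := exists_copy_free_or_explorable (H := H) (m := m) fun j => by
      obtain ⟨J, h1, h2⟩ := exists_maxDensity (H j)
      refine ⟨J, h1, h2 ▸ ?_⟩
      rw [← beta_eq_maxDensity_right hi (hm_pos.trans_le (hle i j))]
      exact mul_le_mul_of_nonneg_right (hle i j) (Nat.cast_nonneg _)
    -- With everything blue there is no red copy, since the graphs are nonempty.
    refine ⟨K, fun n G => (hK n G).imp_left fun h => ⟨fun _ => Colour.blue, fun i' => ?_,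
      fun j => fun ⟨f, _⟩ => (h j).false f⟩⟩
    rintro ⟨f, hf⟩
    obtain ⟨v⟩ := ‹∀ i, Nonempty (V i)› i'
    exact Colour.noConfusion (hf v)
  by_cases hH0 : ∃ j, numEdges (H j) = 0
  · obtain ⟨j, hj⟩ := hH0
    obtain ⟨K, hK⟩ := exists_copy_free_or_explorable (H := F) (m := m) fun i => by
      obtain ⟨J, h1, h2⟩ := exists_maxDensity (F i)
      refine ⟨J, h1, h2 ▸ ?_⟩
      rw [← beta_eq_maxDensity_left hj (hm_pos.trans_le (hle i j))]
      exact mul_le_mul_of_nonneg_right (hle i j) (Nat.cast_nonneg _)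
    refine ⟨K, fun n G => (hK n G).imp_left fun h => ⟨fun _ => Colour.red,
      fun i => fun ⟨f, _⟩ => (h i).false f, fun j' => ?_⟩⟩
    rintro ⟨f, hf⟩
    obtain ⟨v⟩ := ‹∀ j, Nonempty (W j)› j'
    exact Colour.noConfusion (hf v)
  push Not at hF0 hH0
  have hF1 : ∀ i, 1 ≤ numEdges (F i) := fun i => Nat.one_le_iff_ne_zero.2 (hF0 i)
  have hH1 : ∀ j, 1 ≤ numEdges (H j) := fun j => Nat.one_le_iff_ne_zero.2 (hH0 j)
  have : Nonempty ι := ⟨i₀⟩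
  have : Nonempty κ := ⟨j₀⟩
  obtain ⟨i, hi⟩ := Finite.exists_min fun i => oneDensity (F i)
  obtain ⟨j, hj⟩ := Finite.exists_min fun j => oneDensity (H j)
  -- The family containing the least 1-density `μ` plays the red part. Only the pairs with its
  -- minimising member are needed to find the dense subgraphs of the other family.
  rcases le_or_gt (oneDensity (F i)) (oneDensity (H j)) with h | h
  · refine exists_colouring_or_explorable (oneDensity_pos (hF1 i)) ?_ (fun i' => ?_)
      (fun j' => ?_) Colour.noConfusion
    · rw [hm₀]
      exact min_oneDensity_le_beta (hF1 _) (hH1 _) (hi i₀) (h.trans (hj j₀))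
    · obtain ⟨J, h1, h2⟩ := exists_oneDensity (hF1 i')
      refine ⟨J, h1, h2 ▸ mul_le_mul_of_nonneg_right (hi i') ?_⟩
      have : (2 : ℝ) ≤ J.verts.ncard := by exact_mod_cast h1
      linarith
    · obtain ⟨J, h1, h2⟩ := exists_kreuterDensity (F i) (hH1 j')
      refine ⟨J, h1, ?_⟩
      have h3 := hle i j'
      rw [beta_eq_kreuterDensity (hF1 i) (h.trans (hj j'))] at h3
      have := mul_le_mul_of_nonneg_right h3 (Nat.cast_nonneg (α := ℝ) J.verts.ncard)
      linarith
  -- The same with the two families and the two colours exchanged.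
  · obtain ⟨K, hK⟩ := exists_colouring_or_explorable (F := H) (H := F) (m := m)
      (oneDensity_pos (hH1 j)) (by
        rw [hm₀]
        exact min_oneDensity_le_beta (hF1 _) (hH1 _) (h.le.trans (hi i₀)) (hj j₀))
      (fun j' => by
        obtain ⟨J, h1, h2⟩ := exists_oneDensity (hH1 j')
        refine ⟨J, h1, h2 ▸ mul_le_mul_of_nonneg_right (hj j') ?_⟩
        have : (2 : ℝ) ≤ J.verts.ncard := by exact_mod_cast h1
        linarith)
      (fun i' => by
        obtain ⟨J, h1, h2⟩ := exists_kreuterDensity (H j) (hF1 i')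
        refine ⟨J, h1, ?_⟩
        have h3 := hle i' j
        rw [beta_eq_kreuterDensity_swap (hH1 j) (h.trans_le (hi i'))] at h3
        have := mul_le_mul_of_nonneg_right h3 (Nat.cast_nonneg (α := ℝ) J.verts.ncard)
        linarith)
      (k₁ := Colour.blue) (k₂ := Colour.red) Colour.noConfusion
    exact ⟨K, fun n G => (hK n G).imp_left fun ⟨c, h1, h2⟩ => ⟨c, h2, h1⟩⟩
end
end VertexRamsey

/-- If `m > 0` is the minimum of `β(F, H)` over two finite families of finite nonempty graphs and
`p = o(n ^ (-1 / m))`, then with high probability `G(n, p)` has a red/blue vertex colouring with no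
red copy of a member of the first family and no blue copy of a member of the second one. -/
theorem proposition2p1 {ι κ : Type*} [Finite ι] [Finite κ]
    {V : ι → Type*} [∀ i, Finite (V i)] [∀ i, Nonempty (V i)]
    {W : κ → Type*} [∀ j, Finite (W j)] [∀ j, Nonempty (W j)]
    (F : ∀ i, SimpleGraph (V i)) (H : ∀ j, SimpleGraph (W j))
    (m : ℝ) (hm : IsLeast {x : ℝ | ∃ (i : ι) (j : κ), x = VertexRamsey.beta (F i) (H j)} m)
    (hm_pos : 0 < m)
    (p : ℕ → unitInterval)
    (hp : (fun n : ℕ => (p n : ℝ)) =o[atTop] (fun n : ℕ => (n : ℝ) ^ (-1 / m))) :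
    Tendsto
      (fun n : ℕ => SimpleGraph.binomialRandom (Fin n) (p n)
        {G : SimpleGraph (Fin n) | ∃ c : Fin n → VertexRamsey.Colour,
          (∀ i, ¬ VertexRamsey.HasCopyOfColour G c VertexRamsey.Colour.red (F i)) ∧
          (∀ j, ¬ VertexRamsey.HasCopyOfColour G c VertexRamsey.Colour.blue (H j))})
      atTop (𝓝 1) := by
  obtain ⟨K, hK⟩ := VertexRamsey.exists_forall_colouring_or_explorable hm hm_pos
  have h0 := VertexRamsey.tendsto_explorable hm_pos K hp
  have h1 := ENNReal.Tendsto.sub (tendsto_const_nhds (x := (1 : ENNReal))) h0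
    (Or.inl ENNReal.one_ne_top)
  rw [tsub_zero] at h1
  refine tendsto_of_tendsto_of_tendsto_of_le_of_le h1 tendsto_const_nhds (fun n => ?_)
    fun n => MeasureTheory.prob_le_one
  refine tsub_le_iff_right.2 ?_
  rw [← MeasureTheory.measure_univ (μ := SimpleGraph.binomialRandom (Fin n) (p n))]
  refine (MeasureTheory.measure_mono fun G _ => ?_).trans (MeasureTheory.measure_union_le _ _)
  exact hK n G
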